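/- **Setting.** Consider a stochastic bandit with arms $1,\dots,K$. Arm $i$ has a reward distribution $\nu_i$ supported on $[0,1]$ with mean $\mu_i$. One arm, called $o$, is the unique optimal arm. For $i\ne o$ put $$\Delta_i=\mu_o-\mu_i>0,\qquad x_i=\mu_i+\tfrac{\Delta_i}{3},\qquad y_i=\mu_i+\tfrac{2\Delta_i}{3}=\mu_o-\tfrac{\Delta_i}{3}.$$ **Algorithm (Anchor-TS without offline data).** At the start of round $t=1,2,\dots$ let $T_i(t)$ be the number of earlier plays of arm $i$, and let $\hat\mu_i(t)$ be the sum of the rewards observed from arm $i$ so far, divided by $T_i(t)+1$. Let $\mathcal F_{t-1}$ be the history of arms played and rewards observed before round $t$. Given $\mathcal F_{t-1}$, draw independently for every arm $i$ two samples $\theta_{i,1}(t),\theta_{i,2}(t)\sim\mathcal N\bigl(\hat\mu_i(t),\tfrac1{T_i(t)+1}\bigr)$. Put $\hat\theta_i(t)=\mathrm{median}\{\theta_{i,1}(t),\theta_{i,2}(t),\hat\mu_i(t)\}$, play an arm $A(t)\in\arg\max_i\hat\theta_i(t)$ (ties are broken arbitrarily), and observe a reward $R(t)$ drawn from $\nu_{A(t)}$,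 independently of the past given $A(t)$. The regret is $\mathrm{Reg}(T)=T\mu_o-\mathbb E\bigl[\sum_{t=1}^T R(t)\bigr]$. **Reference quantities.** The following are the logarithmic terms in the classical regret bound for Thompson sampling with one Gaussian posterior sample per arm, where $\log^+ u=\max\{\log u,0\}$ with $\log^+0=0$: $$L_i(T)=\frac{2\log^+(T\Delta_i^2)}{(y_i-x_i)^2}=\frac{18\log^+(T\Delta_i^2)}{\Delta_i^2}\quad\text{(suboptimal arm)},\qquad M_i(T)=(e^{64}+5)\,\frac{288\log(T\Delta_i^2+e^{32})}{\Delta_i^2}\quad\text{(optimal arm)}.$$ Let $p_{i,t}=\Pr(\hat\theta_o(t)>y_i\mid\mathcal F_{t-1})$ and $p^{\mathrm{on}}_{i,t}=\Pr(\theta_{o,1}(t)>y_i\mid\mathcal F_{t-1})$. Let $\tau_k$ be the round of the $k$-th play of arm $o$, with $\tau_0=0$; in the expectations below, the integrand is taken to be $0$ where $\tau_k=\infty$. **Statement.** There is a universal constant $C>0$ such that for every bandit instance as above, every such run of the algorithm and every horizon $T$, the following hold. 1. (Suboptimal-arm term.) For every $i\ne o$, $$\sum_{t=1}^T\Pr\bigl(A(t)=i,\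 \hat\mu_i(t)\le x_i,\ \hat\theta_i(t)>y_i\bigr)\le \tfrac12L_i(T)+\frac1{\Delta_i^2}.$$ 2. (Optimal-arm term.) For every $i\ne o$, write $$G_i=\sum_{k=0}^{T-1}\mathbb E\Bigl[\tfrac{1-p_{i,\tau_k+1}}{p_{i,\tau_k+1}}\mathbf 1\{\hat\mu_o(\tau_k+1)>y_i\}\Bigr],\qquad B_i=\sum_{k=0}^{T-1}\mathbb E\Bigl[\tfrac{1-p_{i,\tau_k+1}}{p_{i,\tau_k+1}}\mathbf 1\{\hat\mu_o(\tau_k+1)\le y_i\}\Bigr],\qquad S_i=\sum_{k=0}^{T-1}\mathbb E\Bigl[\tfrac1{p^{\mathrm{on}}_{i,\tau_k+1}}-1\Bigr].$$ Then $$\sum_{t=1}^T\Pr\bigl(A(t)=i,\ \hat\mu_i(t)\le x_i,\ \hat\theta_i(t)\le y_i\bigr)\le G_i+B_i,\qquad G_i\le\tfrac12S_i,\qquad S_i\le M_i(T)+\frac C{\Delta_i^2},\qquad B_i\le\frac C{\Delta_i^2},$$ and $$\sum_{t=1}^T\Pr\bigl(A(t)=i,\ \hat\mu_i(t)\le x_i,\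 \hat\theta_i(t)\le y_i\bigr)\le\tfrac12M_i(T)+\frac C{\Delta_i^2}.$$ 3. (Regret.) $$\mathrm{Reg}(T)\le\sum_{i\ne o}\Delta_i\Bigl(\tfrac12L_i(T)+\tfrac12M_i(T)+\frac C{\Delta_i^2}\Bigr).$$ -/

import Mathlib

open MeasureTheory ProbabilityTheory
open scoped ENNReal NNReal

namespace AnchorTS

noncomputable section

/-- Median of three real numbers. -/
def median3 (a b c : ℝ) : ℝ := max (min a b) (min (max a b) c)

/-- The random quantities of a run on `K` arms. Rounds are numbered `0, 1, 2, …`: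
`A t` is the arm played in round `t`, `R t` is the reward observed in round `t`, and
`θ 0 i t`, `θ 1 i t` are the two posterior samples drawn for arm `i` in round `t`. -/
structure Trajectory (Ω : Type*) (K : ℕ) where
  A : ℕ → Ω → Fin K
  R : ℕ → Ω → ℝ
  θ : Fin 2 → Fin K → ℕ → Ω → ℝ

namespace Trajectory

variable {Ω : Type*} {K : ℕ} (X : Trajectory Ω K)

/-- Number of plays of arm `i` strictly before round `t`. -/
def pulls (i : Fin K) (t : ℕ) (ω : Ω) : ℕ :=
  ((Finset.range t).filter (fun s => X.A s ω = i)).card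

/-- Sum of the rewards observed from arm `i` strictly before round `t`. -/
def rewardSum (i : Fin K) (t : ℕ) (ω : Ω) : ℝ :=
  ∑ s ∈ (Finset.range t).filter (fun s => X.A s ω = i), X.R s ω

/-- The online mean `μ̂_i(t)`: the mean of the Gaussian posterior (standard normal prior, unit noise
variance), that is, the reward sum divided by the number of plays plus one. -/
def postMean (i : Fin K) (t : ℕ) (ω : Ω) : ℝ :=
  X.rewardSum i t ω / ((X.pulls i t ω : ℝ) + 1)

/-- The online posterior variance. -/
def postVar (i : Fin K) (t : ℕ) (ω : Ω) : ℝ≥0 :=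
  ((X.pulls i t ω : ℝ≥0) + 1)⁻¹

/-- The median index `θ̂_i(t)` of arm `i`. -/
def index (i : Fin K) (t : ℕ) (ω : Ω) : ℝ :=
  median3 (X.θ 0 i t ω) (X.θ 1 i t ω) (X.postMean i t ω)

/-- The history before round `t`: the σ-algebra generated by the arms played and the rewards
observed in rounds `s < t`. -/
abbrev history (t : ℕ) : MeasurableSpace Ω :=
  ⨆ s : Fin t, MeasurableSpace.comap (X.A s) ⊤ ⊔ MeasurableSpace.comap (X.R s) (borel ℝ)

/-- The information available in round `t` just before the reward is observed: the history, the
posterior samples of round `t`, and the arm played in round `t`. -/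
abbrev preReward (t : ℕ) : MeasurableSpace Ω :=
  X.history t ⊔ (⨆ (j : Fin 2) (i : Fin K), MeasurableSpace.comap (X.θ j i t) (borel ℝ)) ⊔
    MeasurableSpace.comap (X.A t) ⊤

end Trajectory

/-- `X` is a run, under the probability measure `P`, of Anchor-TS without offline data on the bandit
whose arm `i` has reward distribution `ν i`. Ties in the argmax may be broken in any way. -/
structure IsRun {Ω : Type*} [MeasurableSpace Ω] {K : ℕ} (ν : Fin K → Measure ℝ) (P : Measure Ω)
    (X : Trajectory Ω K) : Prop where
  measurable_arm : ∀ t, Measurable (X.A t)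
  measurable_reward : ∀ t, Measurable (X.R t)
  measurable_sample : ∀ j i t, Measurable (X.θ j i t)
  /-- Given the history, the samples of round `t` are independent, and the two samples of arm `i`
  have the posterior law `N(μ̂_i(t), 1 / (T_i(t) + 1))`. -/
  sample_law : ∀ (t : ℕ) (B : Fin 2 → Fin K → Set ℝ), (∀ j i, MeasurableSet (B j i)) →
    P⟦{ω | ∀ j i, X.θ j i t ω ∈ B j i} | X.history t⟧ =ᵐ[P]
      fun ω => ∏ j, ∏ i, (gaussianReal (X.postMean i t ω) (X.postVar i t ω)).real (B j i)
  /-- The arm played maximises the median index. -/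
  select : ∀ t, ∀ᵐ ω ∂P, ∀ i, X.index i t ω ≤ X.index (X.A t ω) t ω
  /-- The reward is a fresh draw from the distribution of the arm played. -/
  reward_law : ∀ (t : ℕ) (B : Set ℝ), MeasurableSet B →
    P⟦{ω | X.R t ω ∈ B} | X.preReward t⟧ =ᵐ[P] fun ω => (ν (X.A t ω)).real B

/-- Mean reward of arm `i`. -/
def armMean {K : ℕ} (ν : Fin K → Measure ℝ) (i : Fin K) : ℝ := ∫ x, x ∂(ν i)

/-- Sub-optimality gap `Δ_i` of arm `i` with respect to the arm `o`. -/
def gap {K : ℕ} (ν : Fin K → Measure ℝ) (o i : Fin K) : ℝ := armMean ν o - armMean ν i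

/-- The lower threshold `x_i = μ_i + Δ_i / 3`. -/
def lowThr {K : ℕ} (ν : Fin K → Measure ℝ) (o i : Fin K) : ℝ := armMean ν i + gap ν o i / 3

/-- The upper threshold `y_i = μ_i + 2 Δ_i / 3`. -/
def highThr {K : ℕ} (ν : Fin K → Measure ℝ) (o i : Fin K) : ℝ := armMean ν i + 2 * gap ν o i / 3

/-- The exploration threshold `L_i(T) = 2 log⁺(T Δ_i²) / (y_i - x_i)²` of the suboptimal-arm term in
the classical analysis of Thompson sampling. -/
def subThreshold {K : ℕ} (ν : Fin K → Measure ℝ) (o i : Fin K) (T : ℕ) : ℝ :=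
  2 * max (Real.log (T * gap ν o i ^ 2)) 0 / (highThr ν o i - lowThr ν o i) ^ 2

/-- The logarithmic part `(e^64 + 5) · 288 log(T Δ_i² + e^32) / Δ_i²` of the optimal-arm term in the
classical analysis of Thompson sampling. -/
def optTerm {K : ℕ} (ν : Fin K → Measure ℝ) (o i : Fin K) (T : ℕ) : ℝ :=
  (Real.exp 64 + 5) *
    (288 * Real.log (T * gap ν o i ^ 2 + Real.exp 32) / gap ν o i ^ 2)

section Terms

variable {Ω : Type*} [MeasurableSpace Ω] {K : ℕ} (ν : Fin K → Measure ℝ) (P : Measure Ω)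
  (X : Trajectory Ω K) (o i : Fin K)

/-- Expected cumulative regret over the first `T` rounds, `o` being the optimal arm. -/
def regret (T : ℕ) : ℝ :=
  T * armMean ν o - ∫ ω, ∑ t ∈ Finset.range T, X.R t ω ∂P

/-- Arm `i` is played in round `t` with an accurate mean and an over-optimistic index. -/
def overEvent (t : ℕ) : Set Ω :=
  {ω | X.A t ω = i ∧ X.postMean i t ω ≤ lowThr ν o i ∧ highThr ν o i < X.index i t ω}

/-- Arm `i` is played in round `t` with an accurate mean and an index that is not over-optimistic. -/
def underEvent (t : ℕ) : Set Ω :=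
  {ω | X.A t ω = i ∧ X.postMean i t ω ≤ lowThr ν o i ∧ X.index i t ω ≤ highThr ν o i}

/-- Conditional probability, given the history before round `t`, that the median index of the
optimal arm exceeds `y_i`. -/
def pMed (t : ℕ) : Ω → ℝ := P⟦{ω | highThr ν o i < X.index o t ω} | X.history t⟧

/-- Conditional probability, given the history before round `t`, that a single posterior sample of
the optimal arm exceeds `y_i`. -/
def pOn (t : ℕ) : Ω → ℝ := P⟦{ω | highThr ν o i < X.θ 0 o t ω} | X.history t⟧

/-- The optimal arm is played at least `k` times. -/
def reached (k : ℕ) : Set Ω := {ω | ∃ t, X.pulls o t ω = k}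

/-- The round that follows the `k`-th play of the optimal arm (round `0` if `k = 0`); meaningful
on `reached`. -/
def nextRound (k : ℕ) (ω : Ω) : ℕ := sInf {t | X.pulls o t ω = k}

/-- `∑_{k < T} E[(1 - p) / p · 1{μ̂_o > y_i}]`, everything evaluated in the round that follows the
`k`-th play of the optimal arm. -/
def ratioGood (T : ℕ) : ℝ≥0∞ :=
  ∑ k ∈ Finset.range T,
    ∫⁻ ω in reached X o k ∩ {ω | highThr ν o i < X.postMean o (nextRound X o k ω) ω},
      ENNReal.ofReal ((1 - pMed ν P X o i (nextRound X o k ω) ω) /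
        pMed ν P X o i (nextRound X o k ω) ω) ∂P

/-- The same sum over the complementary event `μ̂_o ≤ y_i`. -/
def ratioBad (T : ℕ) : ℝ≥0∞ :=
  ∑ k ∈ Finset.range T,
    ∫⁻ ω in reached X o k ∩ {ω | X.postMean o (nextRound X o k ω) ω ≤ highThr ν o i},
      ENNReal.ofReal ((1 - pMed ν P X o i (nextRound X o k ω) ω) /
        pMed ν P X o i (nextRound X o k ω) ω) ∂P

/-- `∑_{k < T} E[1 / p_on - 1]`: the corresponding quantity of Thompson sampling with a single
posterior sample. -/
def ratioSingle (T : ℕ) : ℝ≥0∞ :=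
  ∑ k ∈ Finset.range T,
    ∫⁻ ω in reached X o k,
      ENNReal.ofReal (1 / pOn ν P X o i (nextRound X o k ω) ω - 1) ∂P

end Terms

end

end AnchorTS

/-! The gain over one posterior sample comes from one observation on medians. Let `q` be the
posterior probability that a single sample of an arm exceeds `y`. If the posterior mean is at most
`y`, the median exceeds `y` exactly when both samples do, so this has probability `q ^ 2`. If the
mean exceeds `y`, the median stays below exactly when both samples do, so exceeding has probability
`1 - (1 - q) ^ 2`.

Suboptimal arm: squaring the Gaussian tail doubles its exponent, so half the usual number of plays
makes over-optimism in a round as rare as `1 / (T Δ ^ 2)` (`IsRun.sum_overEvent_le`).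

Optimal arm: given the history, the samples of `o` are independent of those of the other arms.
Exchanging "the index of `o` is low" for "the index of `o` is high, hence `o` is played" costs a
factor `(1 - p) / p` (`IsRun.measure_index_arm_le`). Regrouping the plays of `o` by their number
gives the good and bad sums. On the good event, `(1 - p) / p = (1 - q) ^ 2 / (q (2 - q))` is at most
half of `1 / q - 1`. On the bad event it is at most `1 / q ^ 2`.

Both `1 / q - 1` and the bad ratio are then bounded pointwise by a constant times `exp (9/5 · Z ^ 2
/ n) · exp (-n Δ ^ 2 / 144)`. Here `n = k + 1` and `Z` is the centred reward sum of the first `k`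
plays. A Gaussian mixture of exponential supermartingales bounds the expectation of the first factor
by `√10` (`IsRun.setLIntegral_reached_le`), and the second is summable over `k` with sum at most
`144 / Δ ^ 2`. So these sums are `O(1 / Δ ^ 2)` with no logarithm, and `optTerm` enters only through
its nonnegativity.

The regret bound adds the plays with an inaccurate mean, which the same exponential moment controls
(`IsRun.sum_lowThr_lt_postMean_le`). -/

namespace AnchorTS

/-! ### Tails of real Gaussian measures -/

lemma hasSubgaussianMGF_gaussianReal (m : ℝ) (v : ℝ≥0) :
    HasSubgaussianMGF (fun x => x - m) v (gaussianReal m v) := by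
  have hmap : (gaussianReal m v).map (fun x => x - m) = gaussianReal 0 v := by
    rw [gaussianReal_map_sub_const, sub_self]
  constructor
  · intro t
    have h := integrable_exp_mul_gaussianReal (μ := m) (v := v) t
    have : (fun x : ℝ => Real.exp (t * (x - m))) =
        fun x => Real.exp (t * x) * Real.exp (-(t * m)) := by
      funext x
      rw [← Real.exp_add]
      ring_nf
    rw [this]
    exact h.mul_const _
  · intro t
    rw [mgf_gaussianReal hmap]
    simp

lemma gaussianReal_real_Ioi_le (m : ℝ) (v : ℝ≥0) {y : ℝ} (h : m ≤ y) :
    (gaussianReal m v).real (Set.Ioi y) ≤ Real.exp (-(y - m) ^ 2 / (2 * v)) := by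
  refine le_trans (measureReal_mono ?_) ((hasSubgaussianMGF_gaussianReal m v).measure_ge_le
    (sub_nonneg.2 h))
  intro x hx
  simp only [Set.mem_Ioi, Set.mem_ofPred_eq] at *
  linarith

lemma gaussianReal_real_Iic_le (m : ℝ) (v : ℝ≥0) {y : ℝ} (h : y ≤ m) :
    (gaussianReal m v).real (Set.Iic y) ≤ Real.exp (-(y - m) ^ 2 / (2 * v)) := by
  have := (hasSubgaussianMGF_gaussianReal m v).neg.measure_ge_le (sub_nonneg.2 h)
  rw [← neg_sub, neg_sq] at this
  refine le_trans (measureReal_mono ?_) this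
  intro x hx
  simp only [Set.mem_Iic, Set.mem_ofPred_eq, Pi.neg_apply] at *
  linarith

/-- The density is integrated only over one standard deviation to the right of `max y m`, where it
is decreasing and hence at least its value at the right end. This loses the `+ 1` in the exponent
but needs no Mills ratio. -/
lemma gaussianReal_real_Ioi_ge (m y : ℝ) {v : ℝ≥0} (hv : v ≠ 0) :
    Real.exp (-(max ((y - m) / √(v : ℝ)) 0 + 1) ^ 2 / 2) / √(2 * Real.pi)
      ≤ (gaussianReal m v).real (Set.Ioi y) := by
  have hv0 : (0 : ℝ) < v := by positivity
  set s : ℝ := √(v : ℝ) with hs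
  have hs0 : 0 < s := Real.sqrt_pos.2 hv0
  have hs2 : s ^ 2 = v := Real.sq_sqrt hv0.le
  set y' : ℝ := max y m with hy'
  have hyy' : y ≤ y' := le_max_left _ _
  have hmy' : m ≤ y' := le_max_right _ _
  have hw : max ((y - m) / s) 0 = (y' - m) / s := by
    rw [hy', max_sub_sub_right y m m |>.symm, sub_self, ← max_div_div_right hs0.le, zero_div]
  set c : ℝ := Real.exp (-(max ((y - m) / s) 0 + 1) ^ 2 / 2) / √(2 * Real.pi) / s with hc
  have hpdf : ∀ x ∈ Set.Ioc y' (y' + s), c ≤ gaussianPDFReal m v x := by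
    intro x hx
    rw [gaussianPDFReal, hc, hw, div_div, div_eq_inv_mul, ← hs2,
      Real.sqrt_mul (by positivity) (s ^ 2), Real.sqrt_sq hs0.le]
    refine mul_le_mul_of_nonneg_left (Real.exp_le_exp.2 ?_) (by positivity)
    have h1 : -((y' - m) / s + 1) ^ 2 / 2 = -(y' + s - m) ^ 2 / (2 * s ^ 2) := by
      field_simp
      ring
    rw [h1]
    refine div_le_div_of_nonneg_right (neg_le_neg ?_) (by positivity)
    have := hx.1
    have := hx.2
    exact pow_le_pow_left₀ (by linarith) (by linarith) 2
  have hsub : Set.Ioc y' (y' + s) ⊆ Set.Ioi y := fun x hx => lt_of_le_of_lt hyy' hx.1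
  refine le_trans ?_ (measureReal_mono hsub)
  rw [measureReal_def, gaussianReal_apply_eq_integral m hv, ENNReal.toReal_ofReal
    (integral_nonneg fun x => gaussianPDFReal_nonneg _ _ _)]
  have hint := setIntegral_mono_on (μ := volume) (s := Set.Ioc y' (y' + s)) (f := fun _ => c)
    (g := gaussianPDFReal m v) (integrableOn_const (by simp))
    (integrable_gaussianPDFReal m v).integrableOn measurableSet_Ioc hpdf
  refine le_trans (le_of_eq ?_) hint
  simp [hc, hs0.le]
  field_simp

/-- The subgaussian mixture bound: an exponential moment of the square. -/
lemma lintegral_exp_sq_le {Ω : Type*} [MeasurableSpace Ω] {P : Measure Ω} [SFinite P]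
    {W : Ω → ℝ} (hW : Measurable W) {n : ℝ} (hn : 0 < n)
    (h : ∀ l : ℝ, ∫⁻ ω, ENNReal.ofReal (Real.exp (l * W ω)) ∂P
      ≤ ENNReal.ofReal (Real.exp (l ^ 2 * n / 8))) :
    ∫⁻ ω, ENNReal.ofReal (Real.exp (9 / 5 * (W ω ^ 2 / n))) ∂P ≤ ENNReal.ofReal √10 := by
  have gauss : ∀ b : ℝ, 0 < b → ∫⁻ l : ℝ, ENNReal.ofReal (Real.exp (-b * l ^ 2))
      = ENNReal.ofReal √(Real.pi / b) := by
    intro b hb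
    rw [← integral_gaussian b, ofReal_integral_eq_lintegral_ofReal (integrable_exp_neg_mul_sq hb)]
    exact Filter.Eventually.of_forall fun l => (Real.exp_pos _).le
  -- Method of mixtures: the moment bound is integrated against `exp (-b l ^ 2)`. Completing the
  -- square yields `x ^ 2 / (4 b)`, which is `9/5 · x ^ 2 / n` for this `b`. The remaining rate `b -
  -- n / 8 = n / 72` is positive, and `√(b / (n / 72)) = √10`.
  set b : ℝ := 5 / 36 * n with hb
  have hb0 : 0 < b := by positivity
  have hconv : ∀ x : ℝ, ∫⁻ l : ℝ, ENNReal.ofReal (Real.exp (l * x) * Real.exp (-b * l ^ 2))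
      = ENNReal.ofReal (Real.exp (9 / 5 * (x ^ 2 / n))) * ENNReal.ofReal √(Real.pi / b) := by
    intro x
    rw [← gauss b hb0, ← lintegral_const_mul' _ _ ENNReal.ofReal_ne_top,
      ← lintegral_add_right_eq_self _ (x / (2 * b))]
    refine lintegral_congr fun l => ?_
    rw [← ENNReal.ofReal_mul (Real.exp_pos _).le, ← Real.exp_add, ← Real.exp_add]
    congr 2
    rw [hb]
    field_simp
    ring
  have hmeas : Measurable (Function.uncurry fun (ω : Ω) (l : ℝ) =>
      ENNReal.ofReal (Real.exp (l * W ω) * Real.exp (-b * l ^ 2))) := by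
    unfold Function.uncurry
    fun_prop
  have hJ0 : ENNReal.ofReal √(Real.pi / b) ≠ 0 := by
    simp only [ne_eq, ENNReal.ofReal_eq_zero, not_le]
    positivity
  have key : (∫⁻ ω, ENNReal.ofReal (Real.exp (9 / 5 * (W ω ^ 2 / n))) ∂P)
      * ENNReal.ofReal √(Real.pi / b) ≤ ENNReal.ofReal √10 * ENNReal.ofReal √(Real.pi / b) := by
    rw [← lintegral_mul_const' _ _ ENNReal.ofReal_ne_top]
    simp_rw [← hconv]
    rw [lintegral_lintegral_swap hmeas.aemeasurable]
    calc ∫⁻ l : ℝ, ∫⁻ ω, ENNReal.ofReal (Real.exp (l * W ω) * Real.exp (-b * l ^ 2)) ∂P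
        ≤ ∫⁻ l : ℝ, ENNReal.ofReal (Real.exp (-(n / 72) * l ^ 2)) := by
          refine lintegral_mono fun l => ?_
          simp_rw [ENNReal.ofReal_mul (Real.exp_pos _).le]
          rw [lintegral_mul_const' _ _ ENNReal.ofReal_ne_top]
          refine (mul_le_mul_left (h l) _).trans (le_of_eq ?_)
          rw [← ENNReal.ofReal_mul (Real.exp_pos _).le, ← Real.exp_add]
          congr 2
          rw [hb]
          ring
      _ = ENNReal.ofReal √10 * ENNReal.ofReal √(Real.pi / b) := by
          rw [gauss _ (by positivity), ← ENNReal.ofReal_mul (by positivity),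
            ← Real.sqrt_mul (by norm_num)]
          congr 2
          rw [hb]
          field_simp
          norm_num
  exact (ENNReal.mul_le_mul_iff_left hJ0 ENNReal.ofReal_ne_top).1 key

/-- The constant in the bounds for inverse Gaussian tails. -/
noncomputable def tailConst : ℝ := 2 * Real.pi * Real.exp 14

lemma tailConst_pos : 0 < tailConst := by
  unfold tailConst
  positivity

lemma inv_gaussianReal_Ioi_sq_le {n : ℝ≥0} (hn : n ≠ 0) (m y : ℝ) :
    1 / ((gaussianReal m n⁻¹).real (Set.Ioi y)) ^ 2
      ≤ 2 * Real.pi * Real.exp (5 + 5 / 4 * (max (√(n : ℝ) * (y - m)) 0) ^ 2) := by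
  have h := gaussianReal_real_Ioi_ge m y (inv_ne_zero hn)
  have hw : (y - m) / √((n⁻¹ : ℝ≥0) : ℝ) = √(n : ℝ) * (y - m) := by
    rw [NNReal.coe_inv, Real.sqrt_inv, div_inv_eq_mul, mul_comm]
  rw [hw] at h
  set w := max (√(n : ℝ) * (y - m)) 0
  have hpos : 0 < Real.exp (-(w + 1) ^ 2 / 2) / √(2 * Real.pi) := by positivity
  calc 1 / ((gaussianReal m n⁻¹).real (Set.Ioi y)) ^ 2
      ≤ 1 / (Real.exp (-(w + 1) ^ 2 / 2) / √(2 * Real.pi)) ^ 2 :=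
        one_div_le_one_div_of_le (by positivity) (pow_le_pow_left₀ hpos.le h 2)
    _ = 2 * Real.pi * Real.exp ((w + 1) ^ 2) := by
        rw [div_pow, Real.sq_sqrt (by positivity), one_div_div, ← Real.exp_nat_mul,
          div_eq_mul_inv, ← Real.exp_neg]
        congr 2
        push_cast
        ring
    _ ≤ _ := by
        refine mul_le_mul_of_nonneg_left (Real.exp_le_exp.2 ?_) (by positivity)
        -- The difference of the two exponents is `(w - 4) ^ 2 / 4`.
        nlinarith [sq_nonneg (w - 4)]

/-! ### Pointwise bounds on inverse tails at the threshold `μ - Δ / 3` -/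

section Deterministic

variable {n : ℝ≥0} {μ Δ Z : ℝ}

/-- With `n - 1` observations and centred sum `Z`, the posterior mean is `(Z + (n - 1) μ) / n`. The
distance to the threshold, in posterior standard deviations, is exactly `(μ - Z) / √n - √n Δ / 3`;
the summand `μ ≤ 1` is the price of the prior. -/
lemma scaled_threshold_le (hn : 1 ≤ n) (hμ : μ ≤ 1) :
    √(n : ℝ) * ((μ - Δ / 3) - (Z + (n - 1) * μ) / n)
      ≤ (1 + |Z|) / √(n : ℝ) - √(n : ℝ) * Δ / 3 := by
  have hn' : (1 : ℝ) ≤ n := by exact_mod_cast hn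
  have hs : 0 < √(n : ℝ) := Real.sqrt_pos.2 (by linarith)
  have hs2 : √(n : ℝ) ^ 2 = n := Real.sq_sqrt (by linarith)
  generalize √(n : ℝ) = s at *
  have : s * ((μ - Δ / 3) - (Z + (n - 1) * μ) / n) = (μ - Z) / s - s * Δ / 3 := by
    rw [← hs2]
    field_simp
    ring
  rw [this]
  have : (μ - Z) / s ≤ (1 + |Z|) / s :=
    div_le_div_of_nonneg_right (by linarith [neg_abs_le Z]) hs.le
  linarith

lemma scaled_abs_sq_le (hn : 1 ≤ n) :
    ((1 + |Z|) / √(n : ℝ)) ^ 2 ≤ 6 / 5 * (Z ^ 2 / n) + 6 := by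
  have hn' : (1 : ℝ) ≤ n := by exact_mod_cast hn
  rw [div_pow, Real.sq_sqrt (by linarith), div_le_iff₀ (by linarith)]
  have : (6 / 5 * (Z ^ 2 / (n : ℝ)) + 6) * n = 6 / 5 * Z ^ 2 + 6 * n := by
    field_simp
  rw [this, ← sq_abs Z]
  nlinarith [sq_nonneg (|Z| - 5)]

/-- If the threshold is not far below the posterior mean, the noise must have cancelled at least
half of the margin `√n Δ / 3`. The noise term can therefore pay for the decay in `n Δ ^ 2` as well.
-/
lemma inv_sq_le_of_threshold (hn : 1 ≤ n) (hμ : μ ≤ 1) (hΔ : 0 ≤ Δ)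
    (hw : -(√(n : ℝ) * Δ / 3) / 2 ≤ √(n : ℝ) * ((μ - Δ / 3) - (Z + (n - 1) * μ) / n)) :
    1 / ((gaussianReal ((Z + (n - 1) * μ) / n) n⁻¹).real (Set.Ioi (μ - Δ / 3))) ^ 2
      ≤ tailConst * Real.exp (9 / 5 * (Z ^ 2 / n)) * Real.exp (-(n * Δ ^ 2 / 144)) := by
  have hn0 : n ≠ 0 := by positivity
  have hn' : (1 : ℝ) ≤ n := by exact_mod_cast hn
  refine (inv_gaussianReal_Ioi_sq_le hn0 _ _).trans ?_
  have h1 := scaled_threshold_le (Δ := Δ) (Z := Z) hn hμ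
  have h2 := scaled_abs_sq_le (Z := Z) hn
  have hU : 0 ≤ (1 + |Z|) / √(n : ℝ) := by positivity
  have hD : 0 ≤ √(n : ℝ) * Δ / 3 := by positivity
  have hD2 : (√(n : ℝ) * Δ / 3) ^ 2 = n * Δ ^ 2 / 9 := by
    rw [div_pow, mul_pow, Real.sq_sqrt (by linarith)]
    norm_num
  generalize (1 + |Z|) / √(n : ℝ) = U at *
  generalize √(n : ℝ) * ((μ - Δ / 3) - (Z + (n - 1) * μ) / n) = w at *
  generalize √(n : ℝ) * Δ / 3 = D at *
  have hv : max w 0 ^ 2 ≤ U ^ 2 :=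
    pow_le_pow_left₀ (le_max_right _ _) (max_le (by linarith) hU) 2
  -- From `-D / 2 ≤ w ≤ U - D`. Hence `n Δ ^ 2 / 144 ≤ U ^ 2 / 4`, and the exponents total at most
  -- `5 + 3/2 · U ^ 2 ≤ 14 + 9/5 · Z ^ 2 / n`. This fixes both the `14` in `tailConst` and the `9 /
  -- 5`.
  have hUD : D ^ 2 ≤ 4 * U ^ 2 := by nlinarith
  unfold tailConst
  rw [mul_assoc (2 * Real.pi), mul_assoc (2 * Real.pi), ← Real.exp_add, ← Real.exp_add]
  refine mul_le_mul_of_nonneg_left (Real.exp_le_exp.2 ?_) (by positivity)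
  linarith

lemma gaussianReal_Ioi_pos {v : ℝ≥0} (hv : v ≠ 0) (m y : ℝ) :
    0 < (gaussianReal m v).real (Set.Ioi y) :=
  lt_of_lt_of_le (by positivity) (gaussianReal_real_Ioi_ge m y hv)

lemma gaussianReal_Iic_eq {v : ℝ≥0} (m y : ℝ) :
    (gaussianReal m v).real (Set.Iic y) = 1 - (gaussianReal m v).real (Set.Ioi y) := by
  rw [← Set.compl_Ioi, probReal_compl_eq_one_sub measurableSet_Ioi]

lemma inv_sub_one_le (hn : 1 ≤ n) (hμ : μ ≤ 1) (hΔ : 0 ≤ Δ) :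
    1 / (gaussianReal ((Z + (n - 1) * μ) / n) n⁻¹).real (Set.Ioi (μ - Δ / 3)) - 1
      ≤ tailConst * Real.exp (9 / 5 * (Z ^ 2 / n)) * Real.exp (-(n * Δ ^ 2 / 144)) := by
  have hn0 : n ≠ 0 := by positivity
  have hn' : (1 : ℝ) ≤ n := by exact_mod_cast hn
  set m := (Z + (n - 1) * μ) / n with hm
  set q := (gaussianReal m n⁻¹).real (Set.Ioi (μ - Δ / 3)) with hq
  have hq0 : 0 < q := gaussianReal_Ioi_pos (inv_ne_zero hn0) _ _
  have hq1 : q ≤ 1 := measureReal_le_one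
  have hqsq : 1 / q ≤ 1 / q ^ 2 := one_div_le_one_div_of_le (by positivity) (by nlinarith)
  rcases le_or_gt (-(√(n : ℝ) * Δ / 3) / 2) (√(n : ℝ) * ((μ - Δ / 3) - m)) with hw | hw
  · linarith [inv_sq_le_of_threshold hn hμ hΔ hw]
  -- Here the mean clears the threshold by half the margin: `1 / q` is bounded by a constant and the
  -- decay comes from `1 - q`, whose exponent is at least `D ^ 2 / 8 = n Δ ^ 2 / 72`.
  · have hD : 0 ≤ √(n : ℝ) * Δ / 3 := by positivity
    have hw0 : √(n : ℝ) * ((μ - Δ / 3) - m) ≤ 0 := by linarith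
    have hs : 0 < √(n : ℝ) := Real.sqrt_pos.2 (by linarith)
    have hym : μ - Δ / 3 ≤ m := by nlinarith
    have h1 := inv_gaussianReal_Ioi_sq_le hn0 m (μ - Δ / 3)
    rw [max_eq_right hw0, ← hq] at h1
    have h2 := gaussianReal_real_Iic_le m n⁻¹ hym
    rw [gaussianReal_Iic_eq, ← hq] at h2
    have hD2 : (√(n : ℝ) * Δ / 3) ^ 2 = n * Δ ^ 2 / 9 := by
      rw [div_pow, mul_pow, Real.sq_sqrt (by linarith)]
      norm_num
    have hw2 : (√(n : ℝ) * ((μ - Δ / 3) - m)) ^ 2 = n * ((μ - Δ / 3) - m) ^ 2 := by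
      rw [mul_pow, Real.sq_sqrt (by linarith)]
    have h3 : -((μ - Δ / 3) - m) ^ 2 / (2 * ((n⁻¹ : ℝ≥0) : ℝ)) ≤ -(n * Δ ^ 2 / 144) := by
      have : -((μ - Δ / 3) - m) ^ 2 / (2 * ((n⁻¹ : ℝ≥0) : ℝ)) =
          -(n * ((μ - Δ / 3) - m) ^ 2) / 2 := by
        rw [NNReal.coe_inv]
        field_simp
      rw [this, ← hw2]
      nlinarith
    have h4 : 1 / q - 1 = (1 - q) * (1 / q) := by field_simp
    have h5 := h2.trans (Real.exp_le_exp.2 h3)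
    rw [h4]
    calc (1 - q) * (1 / q)
        ≤ Real.exp (-(n * Δ ^ 2 / 144)) * (2 * Real.pi * Real.exp (5 + 5 / 4 * 0 ^ 2)) :=
          mul_le_mul h5 (hqsq.trans h1) (by positivity) (Real.exp_pos _).le
      _ ≤ Real.exp (-(n * Δ ^ 2 / 144)) *
          (2 * Real.pi * (Real.exp 14 * Real.exp (9 / 5 * (Z ^ 2 / n)))) := by
          gcongr
          rw [← Real.exp_add]
          refine Real.exp_le_exp.2 ?_
          have : 0 ≤ Z ^ 2 / (n : ℝ) := by positivity
          linarith
      _ = _ := by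
          unfold tailConst
          ring

lemma inv_sq_le (hn : 1 ≤ n) (hμ : μ ≤ 1) (hΔ : 0 ≤ Δ)
    (hm : (Z + (n - 1) * μ) / n ≤ μ - Δ / 3) :
    1 / ((gaussianReal ((Z + (n - 1) * μ) / n) n⁻¹).real (Set.Ioi (μ - Δ / 3))) ^ 2
      ≤ tailConst * Real.exp (9 / 5 * (Z ^ 2 / n)) * Real.exp (-(n * Δ ^ 2 / 144)) := by
  refine inv_sq_le_of_threshold hn hμ hΔ ?_
  have h1 : 0 ≤ √(n : ℝ) * Δ / 3 := by positivity
  have h2 : 0 ≤ √(n : ℝ) * ((μ - Δ / 3) - (Z + (n - 1) * μ) / n) :=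
    mul_nonneg (Real.sqrt_nonneg _) (sub_nonneg.2 hm)
  linarith

end Deterministic

/-- The full geometric series equals `1 / (exp c - 1)`, and `exp c - 1 ≥ c`. -/
lemma sum_exp_neg_le {c : ℝ} (hc : 0 < c) (T : ℕ) :
    ∑ k ∈ Finset.range T, Real.exp (-((k + 1) * c)) ≤ 1 / c := by
  have hr : Real.exp (-c) < 1 := by
    rw [Real.exp_lt_one_iff]
    linarith
  have h1 : ∀ k : ℕ, Real.exp (-((k + 1) * c)) = Real.exp (-c) * Real.exp (-c) ^ k := by
    intro k
    rw [← Real.exp_nat_mul, ← Real.exp_add]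
    ring_nf
  simp_rw [h1, ← Finset.mul_sum]
  have h2 : ∑ k ∈ Finset.range T, Real.exp (-c) ^ k ≤ (1 - Real.exp (-c))⁻¹ := by
    rw [← tsum_geometric_of_lt_one (Real.exp_pos _).le hr]
    exact (summable_geometric_of_lt_one (Real.exp_pos _).le hr).sum_le_tsum _
      fun _ _ => by positivity
  refine (mul_le_mul_of_nonneg_left h2 (Real.exp_pos _).le).trans ?_
  rw [← div_eq_mul_inv, div_le_div_iff₀ (by linarith) hc, one_mul, le_sub_iff_add_le]
  have h3 : Real.exp (-c) * Real.exp c = 1 := by rw [← Real.exp_add]; simp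
  nlinarith [Real.add_one_le_exp c, Real.exp_pos (-c)]

/-! ### Combinatorics of the pull counts -/

namespace Trajectory

variable {Ω : Type*} {K : ℕ} (X : Trajectory Ω K) (i : Fin K)

lemma pulls_succ (t : ℕ) (ω : Ω) :
    X.pulls i (t + 1) ω = X.pulls i t ω + if X.A t ω = i then 1 else 0 := by
  unfold pulls
  rw [Finset.range_add_one, Finset.filter_insert]
  split_ifs with h
  · rw [Finset.card_insert_of_notMem (by simp)]
  · rfl

lemma pulls_mono (ω : Ω) : Monotone fun t => X.pulls i t ω :=
  monotone_nat_of_le_succ fun t => by rw [pulls_succ]; omega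

lemma pulls_le (t : ℕ) (ω : Ω) : X.pulls i t ω ≤ t :=
  (Finset.card_filter_le _ _).trans (by simp)

lemma pulls_lt_of_lt {s t : ℕ} {ω : Ω} (h : X.A s ω = i) (hst : s < t) :
    X.pulls i s ω < X.pulls i t ω := by
  have h1 := X.pulls_succ i s ω
  have h2 : X.pulls i (s + 1) ω ≤ X.pulls i t ω := X.pulls_mono i ω hst
  rw [if_pos h] at h1
  omega

lemma exists_pulls_eq {k t : ℕ} {ω : Ω} (h : k ≤ X.pulls i t ω) :
    ∃ s ≤ t, X.pulls i s ω = k := by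
  induction t with
  | zero => exact ⟨0, le_rfl, by have := X.pulls_le i 0 ω; omega⟩
  | succ t ih =>
    rcases h.eq_or_lt with h' | h'
    · exact ⟨t + 1, le_rfl, h'.symm⟩
    · have := X.pulls_succ i t ω
      obtain ⟨s, hs, hk⟩ := ih (by split_ifs at this <;> omega)
      exact ⟨s, by omega, hk⟩

/-- The sum of the centred rewards of the first `k` plays of arm `i`, up to round `t`. -/
noncomputable def cappedSum (k : ℕ) (c : ℝ) (t : ℕ) (ω : Ω) : ℝ :=
  ∑ s ∈ Finset.range t, if X.A s ω = i ∧ X.pulls i s ω < k then X.R s ω - c else 0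

/-- The capped sum freezes after the `k`-th play. A value at a random round can thus be read at any
later fixed round, so no optional stopping is needed. -/
lemma cappedSum_eq {k s t : ℕ} {ω : Ω} (hs : X.pulls i s ω = k) (hst : s ≤ t) (c : ℝ) :
    X.cappedSum i k c t ω = X.rewardSum i s ω - k * c := by
  have : (Finset.range t).filter (fun r => X.A r ω = i ∧ X.pulls i r ω < k)
      = (Finset.range s).filter fun r => X.A r ω = i := by
    ext r
    simp only [Finset.mem_filter, Finset.mem_range]
    constructor
    · rintro ⟨_, hA, hk⟩
      refine ⟨?_, hA⟩
      by_contra! hsr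
      have : X.pulls i s ω ≤ X.pulls i r ω := X.pulls_mono i ω hsr
      omega
    · rintro ⟨hr, hA⟩
      exact ⟨by omega, hA, hs ▸ X.pulls_lt_of_lt i hA hr⟩
  rw [cappedSum, ← Finset.sum_filter, this, Finset.sum_sub_distrib, rewardSum]
  simp [← hs, pulls]

lemma rewardSum_congr {s t : ℕ} {ω : Ω} (h : X.pulls i s ω = X.pulls i t ω) :
    X.rewardSum i s ω = X.rewardSum i t ω := by
  wlog hst : s ≤ t generalizing s t
  · exact (this h.symm (by omega)).symm
  have h1 := X.cappedSum_eq i h hst 0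
  have h2 := X.cappedSum_eq i rfl (le_refl t) (ω := ω) 0
  linarith

lemma postMean_congr {s t : ℕ} {ω : Ω} (h : X.pulls i s ω = X.pulls i t ω) :
    X.postMean i s ω = X.postMean i t ω := by
  rw [postMean, postMean, X.rewardSum_congr i h, h]

lemma postVar_congr {s t : ℕ} {ω : Ω} (h : X.pulls i s ω = X.pulls i t ω) :
    X.postVar i s ω = X.postVar i t ω := by
  rw [postVar, postVar, h]

lemma postVar_ne_zero (t : ℕ) (ω : Ω) : X.postVar i t ω ≠ 0 := by
  unfold postVar
  positivity

lemma pulls_nextRound {k : ℕ} {ω : Ω} (h : ω ∈ reached X i k) :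
    X.pulls i (nextRound X i k ω) ω = k :=
  Nat.sInf_mem (s := {t | X.pulls i t ω = k}) h

lemma nextRound_le {k t : ℕ} {ω : Ω} (h : k ≤ X.pulls i t ω) : nextRound X i k ω ≤ t := by
  obtain ⟨s, hs, hk⟩ := X.exists_pulls_eq i h
  exact (Nat.sInf_le (s := {t | X.pulls i t ω = k}) hk).trans hs

lemma reached_eq_iUnion (k : ℕ) : reached X i k = ⋃ t, {ω | k ≤ X.pulls i t ω} := by
  ext ω
  simp only [Set.mem_iUnion, Set.mem_ofPred_eq]
  exact ⟨fun ⟨t, ht⟩ => ⟨t, ht.ge⟩, fun ⟨t, ht⟩ =>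
    let ⟨s, _, hs⟩ := X.exists_pulls_eq i ht; ⟨s, hs⟩⟩

/-! ### Measurability -/

section Measurability

variable [MeasurableSpace Ω] {X i}

lemma measurable_pulls {t : ℕ} (hA : ∀ s < t, Measurable (X.A s)) :
    Measurable (X.pulls i t) := by
  have : X.pulls i t = fun ω => ∑ s ∈ Finset.range t, if X.A s ω = i then 1 else 0 := by
    funext ω
    rw [pulls, Finset.card_filter]
  rw [this]
  refine Finset.measurable_sum _ fun s hs => Measurable.ite ?_ measurable_const measurable_const
  exact hA s (Finset.mem_range.1 hs) (measurableSet_singleton i)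

lemma measurable_rewardSum {t : ℕ} (hA : ∀ s < t, Measurable (X.A s))
    (hR : ∀ s < t, Measurable (X.R s)) : Measurable (X.rewardSum i t) := by
  have : X.rewardSum i t = fun ω => ∑ s ∈ Finset.range t, if X.A s ω = i then X.R s ω else 0 := by
    funext ω
    simp [rewardSum, Finset.sum_filter]
  rw [this]
  refine Finset.measurable_sum _ fun s hs =>
    Measurable.ite ?_ (hR s (Finset.mem_range.1 hs)) measurable_const
  exact hA s (Finset.mem_range.1 hs) (measurableSet_singleton i)

lemma measurable_postMean {t : ℕ} (hA : ∀ s < t, Measurable (X.A s))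
    (hR : ∀ s < t, Measurable (X.R s)) : Measurable (X.postMean i t) := by
  have h : Measurable fun ω => ((X.pulls i t ω : ℕ) : ℝ) :=
    (measurable_from_top (f := fun n : ℕ => (n : ℝ))).comp (measurable_pulls hA)
  exact (measurable_rewardSum hA hR).div (h.add_const 1)

lemma measurable_cappedSum {k : ℕ} {c : ℝ} {t : ℕ} (hA : ∀ s < t, Measurable (X.A s))
    (hR : ∀ s < t, Measurable (X.R s)) : Measurable (X.cappedSum i k c t) := by
  refine Finset.measurable_sum _ fun s hs => ?_
  have hs := Finset.mem_range.1 hs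
  refine Measurable.ite (MeasurableSet.inter ?_ ?_) ((hR s hs).sub_const c) measurable_const
  · exact hA s hs (measurableSet_singleton i)
  · exact measurable_pulls (fun r hr => hA r (hr.trans hs)) (measurableSet_Iio (a := k))

end Measurability

lemma measurable_arm_history {s t : ℕ} (h : s < t) : Measurable[X.history t] (X.A s) := by
  refine Measurable.of_comap_le ?_
  exact le_trans le_sup_left (le_iSup (fun s : Fin t => MeasurableSpace.comap (X.A s) ⊤ ⊔
    MeasurableSpace.comap (X.R s) (borel ℝ)) ⟨s, h⟩)

lemma measurable_reward_history {s t : ℕ} (h : s < t) : Measurable[X.history t] (X.R s) := by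
  refine Measurable.of_comap_le ?_
  exact le_trans le_sup_right (le_iSup (fun s : Fin t => MeasurableSpace.comap (X.A s) ⊤ ⊔
    MeasurableSpace.comap (X.R s) (borel ℝ)) ⟨s, h⟩)

lemma history_le_preReward (t : ℕ) : X.history t ≤ X.preReward t :=
  le_sup_left.trans le_sup_left

lemma measurable_arm_preReward (t : ℕ) : Measurable[X.preReward t] (X.A t) :=
  Measurable.of_comap_le le_sup_right

lemma measurable_pulls_history (t : ℕ) : Measurable[X.history t] (X.pulls i t) :=
  @measurable_pulls Ω K X i (X.history t) t fun _ h => X.measurable_arm_history h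

lemma measurable_postMean_history (t : ℕ) : Measurable[X.history t] (X.postMean i t) :=
  @measurable_postMean Ω K X i (X.history t) t (fun _ h => X.measurable_arm_history h)
    fun _ h => X.measurable_reward_history h

lemma measurable_cappedSum_history (k : ℕ) (c : ℝ) (t : ℕ) :
    Measurable[X.history t] (X.cappedSum i k c t) :=
  @measurable_cappedSum Ω K X i (X.history t) k c t (fun _ h => X.measurable_arm_history h)
    fun _ h => X.measurable_reward_history h

end Trajectory

lemma setIntegral_condProb {Ω : Type*} {m mΩ : MeasurableSpace Ω} {P : Measure Ω}
    [IsFiniteMeasure P] (hm : m ≤ mΩ) {E S : Set Ω} (hE : MeasurableSet[m] E)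
    (hS : MeasurableSet S) : ∫ ω in E, (P⟦S | m⟧) ω ∂P = P.real (S ∩ E) := by
  rw [setIntegral_condExp hm ((integrable_const _).indicator hS) hE,
    integral_indicator_const _ hS, measureReal_restrict_apply hS]
  simp

/-! ### The rewards -/

section Rewards

variable {Ω : Type*} [mΩ : MeasurableSpace Ω] {K : ℕ} {ν : Fin K → Measure ℝ} {P : Measure Ω}
  {X : Trajectory Ω K}

lemma IsRun.history_le (hX : IsRun ν P X) (t : ℕ) : X.history t ≤ mΩ :=
  iSup_le fun s => sup_le (hX.measurable_arm s).comap_le (hX.measurable_reward s).comap_le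

lemma IsRun.preReward_le (hX : IsRun ν P X) (t : ℕ) : X.preReward t ≤ mΩ :=
  sup_le (sup_le (hX.history_le t)
    (iSup_le fun j => iSup_le fun i => (hX.measurable_sample j i t).comap_le))
    (hX.measurable_arm t).comap_le

lemma IsRun.measurable_pulls (hX : IsRun ν P X) (i : Fin K) (t : ℕ) : Measurable (X.pulls i t) :=
  (X.measurable_pulls_history i t).mono (hX.history_le t) le_rfl

lemma IsRun.measurable_postMean (hX : IsRun ν P X) (i : Fin K) (t : ℕ) :
    Measurable (X.postMean i t) :=
  (X.measurable_postMean_history i t).mono (hX.history_le t) le_rfl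

variable [IsProbabilityMeasure P] [∀ i, IsProbabilityMeasure (ν i)]

lemma IsRun.map_reward_restrict (hX : IsRun ν P X) {t : ℕ} {j : Fin K} {E : Set Ω}
    (hE : MeasurableSet[X.preReward t] E) (hEj : ∀ ω ∈ E, X.A t ω = j) :
    (P.restrict E).map (X.R t) = P E • ν j := by
  ext B hB
  have hE' := hX.preReward_le t _ hE
  have hS : MeasurableSet {ω | X.R t ω ∈ B} := hX.measurable_reward t hB
  rw [Measure.map_apply (hX.measurable_reward t) hB,
    Measure.restrict_apply (hX.measurable_reward t hB), Measure.smul_apply, smul_eq_mul]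
  have h1 := setIntegral_condProb (P := P) (hX.preReward_le t) hE hS
  rw [setIntegral_congr_ae (g := fun _ => (ν j).real B) hE' (by
    filter_upwards [hX.reward_law t B hB] with ω hω hωE
    rw [hω, hEj ω hωE]), setIntegral_const, smul_eq_mul] at h1
  rw [← ENNReal.toReal_eq_toReal_iff' (measure_ne_top _ _)
    (ENNReal.mul_ne_top (measure_ne_top _ _) (measure_ne_top _ _)), ENNReal.toReal_mul]
  exact h1.symm

/-- Tower property in `ℝ≥0∞`: on an event known before the reward and forcing arm `j`, the reward
has law `ν j` independently of the past. The two measures compared agree on `preReward`, so they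
integrate `Y` alike. -/
lemma IsRun.lintegral_mul_reward (hX : IsRun ν P X) {t : ℕ} {j : Fin K} {E : Set Ω}
    (hE : MeasurableSet[X.preReward t] E) (hEj : ∀ ω ∈ E, X.A t ω = j)
    {Y : Ω → ℝ≥0∞} (hY : Measurable[X.preReward t] Y) {g : ℝ → ℝ≥0∞} (hg : Measurable g) :
    ∫⁻ ω in E, Y ω * g (X.R t ω) ∂P = (∫⁻ ω in E, Y ω ∂P) * ∫⁻ x, g x ∂(ν j) := by
  have hm := hX.preReward_le t
  have hgR : Measurable fun ω => g (X.R t ω) := hg.comp (hX.measurable_reward t)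
  have key : ((P.restrict E).withDensity fun ω => g (X.R t ω)).trim hm
      = ((∫⁻ x, g x ∂(ν j)) • P.restrict E).trim hm := by
    refine @Measure.ext _ (X.preReward t) _ _ fun s hs => ?_
    rw [trim_measurableSet_eq hm hs, trim_measurableSet_eq hm hs, withDensity_apply _ (hm _ hs),
      Measure.restrict_restrict (hm _ hs), Measure.smul_apply, Measure.restrict_apply (hm _ hs),
      ← lintegral_map hg (hX.measurable_reward t),
      hX.map_reward_restrict (hs.inter hE) fun ω hω => hEj ω hω.2, lintegral_smul_measure]
    simp only [smul_eq_mul]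
    rw [mul_comm]
  have h1 := lintegral_trim (μ := (P.restrict E).withDensity fun ω => g (X.R t ω)) hm hY
  rw [key, lintegral_trim hm hY, lintegral_smul_measure,
    lintegral_withDensity_eq_lintegral_mul _ hgR (hY.mono hm le_rfl)] at h1
  simp only [smul_eq_mul, Pi.mul_apply] at h1
  rw [mul_comm, h1]
  simp_rw [mul_comm]

lemma lintegral_exp_centred_le {ρ : Measure ℝ} [IsProbabilityMeasure ρ]
    (hρ : ρ (Set.Icc (0 : ℝ) 1)ᶜ = 0) (l : ℝ) :
    ∫⁻ x, ENNReal.ofReal (Real.exp (l * (x - ∫ y, y ∂ρ))) ∂ρ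
      ≤ ENNReal.ofReal (Real.exp (l ^ 2 / 8)) := by
  have h := hasSubgaussianMGF_of_mem_Icc (X := fun x : ℝ => x) (μ := ρ) (a := 0) (b := 1)
    measurable_id.aemeasurable (by exact hρ)
  rw [← ofReal_integral_eq_lintegral_ofReal (h.integrable_exp_mul l)
    (Filter.Eventually.of_forall fun _ => (Real.exp_pos _).le)]
  refine ENNReal.ofReal_le_ofReal ((h.mgf_le l).trans (le_of_eq ?_))
  congr 1
  norm_num
  ring

variable (hsupp : ∀ i, ν i (Set.Icc (0 : ℝ) 1)ᶜ = 0)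

include hsupp in
-- Supermartingale property, by induction on `t`: by Hoeffding's lemma, each counted reward
-- multiplies the expectation by at most `exp (l ^ 2 / 8)`, which the compensator removes. The
-- compensator counts the same plays as the capped sum.
lemma IsRun.lintegral_exp_cappedSum_sub_le (hX : IsRun ν P X) (i : Fin K) (k : ℕ) (l : ℝ) (t : ℕ) :
    ∫⁻ ω, ENNReal.ofReal (Real.exp (l * X.cappedSum i k (armMean ν i) t ω
      - l ^ 2 / 8 * (min (X.pulls i t ω) k : ℕ))) ∂P ≤ 1 := by
  induction t with
  | zero => simp [Trajectory.cappedSum, Trajectory.pulls]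
  | succ t ih =>
    set c := armMean ν i
    set M : Ω → ℝ≥0∞ := fun ω => ENNReal.ofReal (Real.exp (l * X.cappedSum i k c t ω
      - l ^ 2 / 8 * (min (X.pulls i t ω) k : ℕ))) with hM
    set E : Set Ω := {ω | X.A t ω = i ∧ X.pulls i t ω < k} with hE
    have hpulls := X.measurable_pulls_history i t
    have hEm : MeasurableSet[X.preReward t] E := by
      refine MeasurableSet.inter ?_ ?_
      · exact X.measurable_arm_preReward t (measurableSet_singleton i)
      · exact X.history_le_preReward t _ (hpulls (measurableSet_Iio (a := k)))
    have hE' := hX.preReward_le t _ hEm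
    have hMm : Measurable[X.preReward t] M := by
      refine Measurable.mono (?_ : Measurable[X.history t] M) (X.history_le_preReward t) le_rfl
      refine ENNReal.measurable_ofReal.comp (Real.measurable_exp.comp (Measurable.sub ?_ ?_))
      · exact (X.measurable_cappedSum_history i k c t).const_mul l
      · refine Measurable.const_mul ?_ _
        exact (measurable_from_top (f := fun n : ℕ => ((min n k : ℕ) : ℝ))).comp hpulls
    rw [← lintegral_add_compl _ hE']
    refine le_trans ?_ ih
    rw [← lintegral_add_compl M hE']
    refine add_le_add ?_ (le_of_eq ?_)
    · set g : ℝ → ℝ≥0∞ := fun x =>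
        ENNReal.ofReal (Real.exp (-(l ^ 2 / 8))) * ENNReal.ofReal (Real.exp (l * (x - c)))
      have hg : Measurable g := by fun_prop
      calc _ = ∫⁻ ω in E, M ω * g (X.R t ω) ∂P := by
            refine setLIntegral_congr_fun hE' fun ω hω => ?_
            have hω' : X.A t ω = i ∧ X.pulls i t ω < k := hω
            simp only [hM, g]
            rw [← ENNReal.ofReal_mul (Real.exp_pos _).le, ← ENNReal.ofReal_mul (Real.exp_pos _).le,
              ← Real.exp_add, ← Real.exp_add, Trajectory.cappedSum, Finset.sum_range_succ,
              if_pos hω', X.pulls_succ, if_pos hω'.1, min_eq_left (Nat.succ_le_of_lt hω'.2),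
              min_eq_left hω'.2.le, Trajectory.cappedSum]
            congr 2
            push_cast
            ring
        _ = (∫⁻ ω in E, M ω ∂P) * ∫⁻ x, g x ∂(ν i) :=
            hX.lintegral_mul_reward hEm (fun ω hω => hω.1) hMm hg
        _ ≤ (∫⁻ ω in E, M ω ∂P) * 1 := by
            gcongr
            rw [lintegral_const_mul' _ _ ENNReal.ofReal_ne_top]
            refine (mul_le_mul_right (lintegral_exp_centred_le (hsupp i) l) _).trans ?_
            rw [← ENNReal.ofReal_mul (Real.exp_pos _).le, ← Real.exp_add]
            simp
        _ = _ := mul_one _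
    -- Off `E` the round adds nothing: either another arm is played, or the count has already
    -- reached the cap.
    · refine setLIntegral_congr_fun hE'.compl fun ω hω => ?_
      have hω' : ¬ (X.A t ω = i ∧ X.pulls i t ω < k) := hω
      simp only [hM]
      rw [Trajectory.cappedSum, Finset.sum_range_succ, if_neg hω', add_zero, X.pulls_succ,
        Trajectory.cappedSum]
      congr 5
      split_ifs with h
      · have : k ≤ X.pulls i t ω := by
          by_contra! h'
          exact hω' ⟨h, h'⟩
        omega
      · rfl

include hsupp in
-- The compensator is at most `l ^ 2 k / 8`. Weakening `k` to `k + 1` matches the posterior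
-- precision and keeps the denominator positive at `k = 0`.
lemma IsRun.lintegral_exp_cappedSum_sq_le (hX : IsRun ν P X) (i : Fin K) (k t : ℕ) :
    ∫⁻ ω, ENNReal.ofReal (Real.exp (9 / 5 * (X.cappedSum i k (armMean ν i) t ω ^ 2 / (k + 1)))) ∂P
      ≤ ENNReal.ofReal √10 := by
  refine lintegral_exp_sq_le ((X.measurable_cappedSum_history i k _ t).mono (hX.history_le t) le_rfl)
    (by positivity) fun l => ?_
  have h := hX.lintegral_exp_cappedSum_sub_le hsupp i k l t
  calc _ ≤ ∫⁻ ω, ENNReal.ofReal (Real.exp (l ^ 2 * (k + 1) / 8)) *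
        ENNReal.ofReal (Real.exp (l * X.cappedSum i k (armMean ν i) t ω
          - l ^ 2 / 8 * (min (X.pulls i t ω) k : ℕ))) ∂P := by
        refine lintegral_mono fun ω => ?_
        rw [← ENNReal.ofReal_mul (Real.exp_pos _).le, ← Real.exp_add]
        refine ENNReal.ofReal_le_ofReal (Real.exp_le_exp.2 ?_)
        have : ((min (X.pulls i t ω) k : ℕ) : ℝ) ≤ k := by exact_mod_cast min_le_right _ _
        nlinarith [sq_nonneg l]
    _ ≤ ENNReal.ofReal (Real.exp (l ^ 2 * (k + 1) / 8)) * 1 := by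
        rw [lintegral_const_mul' _ _ ENNReal.ofReal_ne_top]
        gcongr
    _ = _ := mul_one _

include hsupp in
/-- Concentration of the rewards of the first `k` plays of an arm, in the round after the `k`-th
play. -/
lemma IsRun.setLIntegral_reached_le (hX : IsRun ν P X) (i : Fin K) (k : ℕ) {f : Ω → ℝ≥0∞}
    {c : ℝ≥0∞} (hc : c ≠ ∞)
    (hf : ∀ᵐ ω ∂P, ω ∈ reached X i k → f ω ≤ c * ENNReal.ofReal (Real.exp (9 / 5 *
      ((X.rewardSum i (nextRound X i k ω) ω - k * armMean ν i) ^ 2 / (k + 1))))) :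
    ∫⁻ ω in reached X i k, f ω ∂P ≤ c * ENNReal.ofReal √10 := by
  -- The event that the `k`-th play ever happens is the increasing union over `t` of the events that
  -- it has happened by round `t`; on each of these the capped sum at `t` is available, with a bound
  -- uniform in `t`.
  have hmono : Monotone fun t => {ω | k ≤ X.pulls i t ω} := fun s t hst ω hω =>
    le_trans (show k ≤ X.pulls i s ω from hω) (X.pulls_mono i ω hst)
  rw [X.reached_eq_iUnion, setLIntegral_iUnion_of_directed _ hmono.directed_le]
  refine iSup_le fun t => ?_
  have hm : MeasurableSet {ω | k ≤ X.pulls i t ω} :=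
    hX.measurable_pulls i t (measurableSet_Ici (a := k))
  calc ∫⁻ ω in {ω | k ≤ X.pulls i t ω}, f ω ∂P
      ≤ ∫⁻ ω in {ω | k ≤ X.pulls i t ω}, c * ENNReal.ofReal (Real.exp (9 / 5 *
        (X.cappedSum i k (armMean ν i) t ω ^ 2 / (k + 1)))) ∂P := by
        refine setLIntegral_mono_ae' hm ?_
        filter_upwards [hf] with ω hω hk
        have hr : ω ∈ reached X i k := by
          rw [X.reached_eq_iUnion]
          exact Set.mem_iUnion.2 ⟨t, hk⟩
        rw [X.cappedSum_eq i (X.pulls_nextRound i hr) (X.nextRound_le i hk)]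
        exact hω hr
    _ ≤ ∫⁻ ω, c * ENNReal.ofReal (Real.exp (9 / 5 *
        (X.cappedSum i k (armMean ν i) t ω ^ 2 / (k + 1)))) ∂P := setLIntegral_le_lintegral _ _
    _ ≤ _ := by
        rw [lintegral_const_mul' _ _ hc]
        gcongr
        exact hX.lintegral_exp_cappedSum_sq_le hsupp i k t

/-! ### Regrouping rounds by pull counts -/

omit [IsProbabilityMeasure P] [∀ i, IsProbabilityMeasure (ν i)] in
-- Each play of arm `i` raises its count, so for fixed `k` at most one round plays it at count `k`.
-- The corresponding events are disjoint in `t` and lie in `reached X i k`. Only `k < T` occurs,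
-- because the count at round `t` is at most `t`.
lemma IsRun.sum_setLIntegral_arm_le (hX : IsRun ν P X) (i : Fin K) (T : ℕ)
    {h H : ℕ → Ω → ℝ≥0∞}
    (hh : ∀ᵐ ω ∂P, ∀ t, X.A t ω = i → h t ω ≤ H (X.pulls i t ω) ω) :
    ∑ t ∈ Finset.range T, ∫⁻ ω in {ω | X.A t ω = i}, h t ω ∂P
      ≤ ∑ k ∈ Finset.range T, ∫⁻ ω in reached X i k, H k ω ∂P := by
  have hA : ∀ t, MeasurableSet {ω | X.A t ω = i} := fun t =>
    hX.measurable_arm t (measurableSet_singleton i)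
  set S : ℕ → ℕ → Set Ω := fun t k => {ω | X.A t ω = i ∧ X.pulls i t ω = k} with hS
  have hSm : ∀ t k, MeasurableSet (S t k) := fun t k =>
    (hA t).inter (hX.measurable_pulls i t (measurableSet_singleton k))
  have h1 : ∀ t ∈ Finset.range T, ∫⁻ ω in {ω | X.A t ω = i}, h t ω ∂P
      ≤ ∑ k ∈ Finset.range T, ∫⁻ ω in S t k, H k ω ∂P := by
    intro t ht
    have hU : {ω | X.A t ω = i} = ⋃ k ∈ Finset.range T, S t k := by
      ext ω
      simp only [Set.mem_ofPred_eq, Set.mem_iUnion, hS, Finset.mem_range, exists_prop]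
      have := X.pulls_le i t ω
      have := Finset.mem_range.1 ht
      exact ⟨fun h => ⟨_, by omega, h, rfl⟩, fun ⟨_, _, h, _⟩ => h⟩
    rw [hU, lintegral_biUnion_finset _ fun k _ => hSm t k]
    · refine Finset.sum_le_sum fun k _ => setLIntegral_mono_ae' (hSm t k) ?_
      filter_upwards [hh] with ω hω hk
      exact hk.2 ▸ hω t hk.1
    · intro k _ k' _ hkk'
      exact Set.disjoint_left.2 fun ω hω hω' => hkk' (hω.2.symm.trans hω'.2)
  refine (Finset.sum_le_sum h1).trans ?_
  rw [Finset.sum_comm]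
  refine Finset.sum_le_sum fun k _ => ?_
  rw [← lintegral_biUnion_finset _ fun t _ => hSm t k]
  · refine lintegral_mono_set fun ω hω => ?_
    simp only [Set.mem_iUnion] at hω
    obtain ⟨t, _, ht⟩ := hω
    exact ⟨t, ht.2⟩
  · intro t _ t' _ htt'
    refine Set.disjoint_left.2 fun ω hω hω' => ?_
    rcases lt_or_gt_of_ne htt' with hlt | hlt
    · have := X.pulls_lt_of_lt i hω.1 hlt
      rw [hω.2, hω'.2] at this
      exact lt_irrefl _ this
    · have := X.pulls_lt_of_lt i hω'.1 hlt
      rw [hω.2, hω'.2] at this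
      exact lt_irrefl _ this

end Rewards

/-! ### The posterior samples -/

/-- This and its mirror image `median3_le_iff` are the source of all squared probabilities below. -/
lemma lt_median3_iff {y a b c : ℝ} (h : c ≤ y) : y < median3 a b c ↔ y < a ∧ y < b := by
  unfold median3
  simp only [lt_max_iff, lt_min_iff]
  exact ⟨fun h' => h'.elim id fun h' => absurd h'.2 h.not_gt, Or.inl⟩

lemma median3_le_iff {y a b c : ℝ} (h : y < c) : median3 a b c ≤ y ↔ a ≤ y ∧ b ≤ y := by
  unfold median3
  simp only [max_le_iff, min_le_iff]
  exact ⟨fun h' => h'.2.elim id fun h' => absurd h' h.not_ge, fun h' => ⟨Or.inl h'.1, Or.inl h'⟩⟩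

namespace Trajectory

variable {Ω : Type*} {K : ℕ} (X : Trajectory Ω K)

/-- The posterior probability that a sample of arm `o` in round `t` lies in `b`. -/
noncomputable def postProb (o : Fin K) (t : ℕ) (b : Set ℝ) (ω : Ω) : ℝ :=
  (gaussianReal (X.postMean o t ω) (X.postVar o t ω)).real b

/-- The posterior probability that the median index of arm `o` exceeds `y`. -/
noncomputable def medProb (o : Fin K) (t : ℕ) (y : ℝ) (ω : Ω) : ℝ :=
  if y < X.postMean o t ω then 1 - (1 - X.postProb o t (Set.Ioi y) ω) ^ 2
  else X.postProb o t (Set.Ioi y) ω ^ 2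

/-- The events that constrain the history before round `t` and the samples drawn in round `t` for
the arms other than `o`. -/
def otherRects (o : Fin K) (t : ℕ) : Set (Set Ω) :=
  {s | ∃ (E : Set Ω) (B : Fin 2 → Fin K → Set ℝ), MeasurableSet[X.history t] E ∧
    (∀ j i, MeasurableSet (B j i)) ∧ (∀ j, B j o = Set.univ) ∧
    s = E ∩ {ω | ∀ j i, X.θ j i t ω ∈ B j i}}

/-- The σ-algebra of the history before round `t` and of the samples drawn in round `t` for the
arms other than `o`. -/
abbrev others (o : Fin K) (t : ℕ) : MeasurableSpace Ω :=
  MeasurableSpace.generateFrom (X.otherRects o t)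

variable (o : Fin K) (t : ℕ)

lemma isPiSystem_otherRects : IsPiSystem (X.otherRects o t) := by
  rintro _ ⟨E, B, hE, hB, hBo, rfl⟩ _ ⟨E', B', hE', hB', hBo', rfl⟩ _
  refine ⟨E ∩ E', fun j i => B j i ∩ B' j i, hE.inter hE', fun j i => (hB j i).inter (hB' j i),
    fun j => by simp [hBo, hBo'], ?_⟩
  ext ω
  simp only [Set.mem_inter_iff, Set.mem_ofPred_eq]
  exact ⟨fun h => ⟨⟨h.1.1, h.2.1⟩, fun j i => ⟨h.1.2 j i, h.2.2 j i⟩⟩,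
    fun h => ⟨⟨h.1.1, fun j i => (h.2 j i).1⟩, h.1.2, fun j i => (h.2 j i).2⟩⟩

lemma history_le_others : X.history t ≤ X.others o t := fun E hE =>
  MeasurableSpace.measurableSet_generateFrom
    ⟨E, fun _ _ => Set.univ, hE, fun _ _ => MeasurableSet.univ, fun _ => rfl, by simp⟩

lemma measurable_sample_others (j : Fin 2) {i : Fin K} (hi : i ≠ o) :
    Measurable[X.others o t] (X.θ j i t) := by
  intro b hb
  refine MeasurableSpace.measurableSet_generateFrom ⟨Set.univ,
    fun j' i' => if j' = j ∧ i' = i then b else Set.univ, MeasurableSet.univ, ?_, ?_, ?_⟩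
  · intro j' i'
    dsimp only
    split_ifs
    · exact hb
    · exact MeasurableSet.univ
  · intro j'
    exact if_neg fun h => hi h.2.symm
  · ext ω
    simp only [Set.mem_preimage, Set.univ_inter, Set.mem_ofPred_eq]
    constructor
    · intro h j' i'
      split_ifs with hc
      · rw [hc.1, hc.2]
        exact h
      · trivial
    · intro h
      simpa using h j i

lemma measurable_index_others {i : Fin K} (hi : i ≠ o) :
    Measurable[X.others o t] (X.index i t) := by
  have h0 := X.measurable_sample_others o t 0 hi
  have h1 := X.measurable_sample_others o t 1 hi
  have hm := (X.measurable_postMean_history i t).mono (X.history_le_others o t) le_rfl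
  exact (h0.min h1).max ((h0.max h1).min hm)

lemma measurable_postProb {b : Set ℝ} (hb : MeasurableSet b) :
    Measurable[X.history t] (X.postProb o t b) := by
  have hv : Measurable[X.history t] (X.postVar o t) :=
    (measurable_from_top (f := fun n : ℕ => ((n : ℝ≥0) + 1)⁻¹)).comp
      (X.measurable_pulls_history o t)
  have hg : Measurable[X.history t] fun ω =>
      gaussianReal (X.postMean o t ω) (X.postVar o t ω) :=
    measurable_gaussianReal.comp (Measurable.prodMk (X.measurable_postMean_history o t) hv)
  exact ENNReal.measurable_toReal.comp ((Measure.measurable_coe hb).comp hg)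

lemma measurable_medProb (y : ℝ) : Measurable[X.history t] (X.medProb o t y) := by
  have hq := X.measurable_postProb o t (measurableSet_Ioi (a := y))
  exact Measurable.ite ((X.measurable_postMean_history o t) (measurableSet_Ioi (a := y)))
    (measurable_const.sub ((measurable_const.sub hq).pow_const 2)) (hq.pow_const 2)

variable {o t}

lemma postProb_nonneg {b : Set ℝ} {ω : Ω} : 0 ≤ X.postProb o t b ω := measureReal_nonneg

lemma postProb_le_one {b : Set ℝ} {ω : Ω} : X.postProb o t b ω ≤ 1 := measureReal_le_one

lemma postProb_Ioi_pos (y : ℝ) (ω : Ω) : 0 < X.postProb o t (Set.Ioi y) ω :=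
  gaussianReal_Ioi_pos (X.postVar_ne_zero o t ω) _ _

lemma postProb_Iic (y : ℝ) (ω : Ω) :
    X.postProb o t (Set.Iic y) ω = 1 - X.postProb o t (Set.Ioi y) ω :=
  gaussianReal_Iic_eq _ _

lemma medProb_pos (y : ℝ) (ω : Ω) : 0 < X.medProb o t y ω := by
  have h0 := X.postProb_Ioi_pos (o := o) (t := t) y ω
  have h1 := X.postProb_le_one (o := o) (t := t) (b := Set.Ioi y) (ω := ω)
  unfold medProb
  split_ifs
  · nlinarith
  · positivity

lemma medProb_le_one (y : ℝ) (ω : Ω) : X.medProb o t y ω ≤ 1 := by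
  have h0 := X.postProb_Ioi_pos (o := o) (t := t) y ω
  have h1 := X.postProb_le_one (o := o) (t := t) (b := Set.Ioi y) (ω := ω)
  unfold medProb
  split_ifs
  · nlinarith [sq_nonneg (1 - X.postProb o t (Set.Ioi y) ω)]
  · nlinarith

end Trajectory

section Sampling

variable {Ω : Type*} [mΩ : MeasurableSpace Ω] {K : ℕ} {ν : Fin K → Measure ℝ} {P : Measure Ω}
  {X : Trajectory Ω K}

lemma IsRun.measurableSet_rect (hX : IsRun ν P X) (t : ℕ) {B : Fin 2 → Fin K → Set ℝ}
    (hB : ∀ j i, MeasurableSet (B j i)) : MeasurableSet {ω | ∀ j i, X.θ j i t ω ∈ B j i} := by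
  have : {ω | ∀ j i, X.θ j i t ω ∈ B j i} = ⋂ j, ⋂ i, X.θ j i t ⁻¹' B j i := by
    ext ω
    simp
  rw [this]
  exact MeasurableSet.iInter fun j => MeasurableSet.iInter fun i =>
    hX.measurable_sample j i t (hB j i)

lemma IsRun.others_le (hX : IsRun ν P X) (o : Fin K) (t : ℕ) : X.others o t ≤ mΩ := by
  refine MeasurableSpace.generateFrom_le ?_
  rintro _ ⟨E, B, hE, hB, _, rfl⟩
  exact (hX.history_le t _ hE).inter (hX.measurableSet_rect t hB)

lemma IsRun.measurable_index (hX : IsRun ν P X) (i : Fin K) (t : ℕ) :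
    Measurable (X.index i t) := by
  have h0 := hX.measurable_sample 0 i t
  have h1 := hX.measurable_sample 1 i t
  exact (h0.min h1).max ((h0.max h1).min (hX.measurable_postMean i t))

variable [IsProbabilityMeasure P] {o : Fin K} {t : ℕ}

omit [IsProbabilityMeasure P] in
lemma IsRun.condProb_sample (hX : IsRun ν P X) {b : Set ℝ} (hb : MeasurableSet b) :
    P⟦{ω | X.θ 0 o t ω ∈ b} | X.history t⟧ =ᵐ[P] X.postProb o t b := by
  have h := hX.sample_law t (fun j i => if j = 0 ∧ i = o then b else Set.univ) fun j i => by
    split_ifs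
    · exact hb
    · exact MeasurableSet.univ
  have hset : {ω | ∀ j i, X.θ j i t ω ∈ if j = 0 ∧ i = o then b else Set.univ}
      = {ω | X.θ 0 o t ω ∈ b} := by
    ext ω
    simp only [Set.mem_ofPred_eq]
    constructor
    · intro h
      simpa using h 0 o
    · intro h j i
      split_ifs with hc
      · rw [hc.1, hc.2]
        exact h
      · trivial
  rw [hset] at h
  filter_upwards [h] with ω hω
  rw [hω, Fin.prod_univ_two, Finset.prod_eq_single o, Finset.prod_eq_one]
  · simp [Trajectory.postProb]
  · intro i _
    simp
  · intro i _ hi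
    simp [hi]
  · simp

omit [IsProbabilityMeasure P] in
lemma lintegral_ofReal_of_bounded [IsFiniteMeasure P] {f : Ω → ℝ} (hf : Measurable f)
    (h0 : ∀ ω, 0 ≤ f ω) (h1 : ∀ ω, f ω ≤ 1) (s : Set Ω) :
    ∫⁻ ω in s, ENNReal.ofReal (f ω) ∂P = ENNReal.ofReal (∫ ω in s, f ω ∂P) := by
  rw [ofReal_integral_eq_lintegral_ofReal]
  · refine Integrable.of_bound hf.aestronglyMeasurable 1 (Filter.Eventually.of_forall fun ω => ?_)
    rw [Real.norm_of_nonneg (h0 ω)]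
    exact h1 ω
  · exact Filter.Eventually.of_forall h0

/-- The two samples of arm `o` are independent of each other and of the samples of the other arms,
given the history. -/
lemma IsRun.trim_pair_eq (hX : IsRun ν P X) {b : Set ℝ} (hb : MeasurableSet b) :
    (P.restrict {ω | X.θ 0 o t ω ∈ b ∧ X.θ 1 o t ω ∈ b}).trim (hX.others_le o t)
      = (P.withDensity fun ω => ENNReal.ofReal (X.postProb o t b ω ^ 2)).trim
        (hX.others_le o t) := by
  have hqF := (X.measurable_postProb o t hb).pow_const 2
  have hq := hqF.mono (hX.history_le t) le_rfl
  -- It suffices to compare the two finite measures on the π-system of rectangles.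
  have key : ∀ s ∈ X.otherRects o t,
      (P.restrict {ω | X.θ 0 o t ω ∈ b ∧ X.θ 1 o t ω ∈ b}).trim (hX.others_le o t) s
      = (P.withDensity fun ω => ENNReal.ofReal (X.postProb o t b ω ^ 2)).trim
        (hX.others_le o t) s := by
    intro s hs
    have hsm : MeasurableSet[X.others o t] s := MeasurableSpace.measurableSet_generateFrom hs
    have hsm' := hX.others_le o t _ hsm
    rw [trim_measurableSet_eq _ hsm, trim_measurableSet_eq _ hsm, Measure.restrict_apply hsm',
      withDensity_apply _ hsm', lintegral_ofReal_of_bounded hq (fun ω => sq_nonneg _)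
      (fun ω => pow_le_one₀ X.postProb_nonneg X.postProb_le_one)]
    obtain ⟨E, B, hE, hB, hBo, rfl⟩ := hs
    have hE' := hX.history_le t _ hE
    -- A rectangle leaves arm `o` free; requiring both its samples to lie in `b` turns it into the
    -- rectangle `B'`. In `sample_law` this multiplies the product by one factor `postProb` for each
    -- of the two samples.
    set B' : Fin 2 → Fin K → Set ℝ := fun j i => if i = o then b else B j i with hB'
    have hBm' : ∀ j i, MeasurableSet (B' j i) := fun j i => by
      simp only [hB']
      split_ifs
      · exact hb
      · exact hB j i
    have hset : E ∩ {ω | ∀ j i, X.θ j i t ω ∈ B j i} ∩ {ω | X.θ 0 o t ω ∈ b ∧ X.θ 1 o t ω ∈ b}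
        = {ω | ∀ j i, X.θ j i t ω ∈ B' j i} ∩ E := by
      ext ω
      simp only [Set.mem_inter_iff, Set.mem_ofPred_eq, hB']
      constructor
      · rintro ⟨⟨h1, h2⟩, h3, h4⟩
        refine ⟨fun j i => ?_, h1⟩
        split_ifs with h
        · subst h
          fin_cases j
          · exact h3
          · exact h4
        · exact h2 j i
      · rintro ⟨h1, h2⟩
        refine ⟨⟨h2, fun j i => ?_⟩, by simpa using h1 0 o, by simpa using h1 1 o⟩
        by_cases h : i = o
        · rw [h, hBo]
          trivial
        · simpa [h] using h1 j i
    have hR := hX.measurableSet_rect t hB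
    rw [hset, ← ofReal_measureReal, ← setIntegral_condProb (hX.history_le t) hE
      (hX.measurableSet_rect t hBm'), Set.inter_comm E, ← Measure.restrict_restrict hR,
      ← integral_indicator hR]
    congr 1
    have hint : Integrable ({ω | ∀ j i, X.θ j i t ω ∈ B j i}.indicator fun _ => (1 : ℝ)) P :=
      (integrable_const _).indicator hR
    have hpull := condExp_stronglyMeasurable_mul_of_bound (hX.history_le t)
      hqF.stronglyMeasurable hint 1 (Filter.Eventually.of_forall fun ω => by
        rw [Real.norm_of_nonneg (sq_nonneg _)]
        exact pow_le_one₀ X.postProb_nonneg X.postProb_le_one)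
    have hint2 : Integrable ((fun ω => X.postProb o t b ω ^ 2) *
        ({ω | ∀ j i, X.θ j i t ω ∈ B j i}.indicator fun _ => (1 : ℝ))) P := by
      refine hint.bdd_mul hq.aestronglyMeasurable (c := 1) (Filter.Eventually.of_forall fun ω => ?_)
      rw [Real.norm_of_nonneg (sq_nonneg _)]
      exact pow_le_one₀ X.postProb_nonneg X.postProb_le_one
    have hind : ({ω | ∀ j i, X.θ j i t ω ∈ B j i}.indicator fun ω => X.postProb o t b ω ^ 2)
        = (fun ω => X.postProb o t b ω ^ 2) *
        ({ω | ∀ j i, X.θ j i t ω ∈ B j i}.indicator fun _ => (1 : ℝ)) := by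
      ext ω
      by_cases h : ω ∈ {ω | ∀ j i, X.θ j i t ω ∈ B j i}
      · rw [Pi.mul_apply, Set.indicator_of_mem h, Set.indicator_of_mem h, mul_one]
      · rw [Pi.mul_apply, Set.indicator_of_notMem h, Set.indicator_of_notMem h, mul_zero]
    rw [hind, ← setIntegral_condExp (hX.history_le t) hint2 hE]
    refine setIntegral_congr_ae hE' ?_
    filter_upwards [hpull, hX.sample_law t B hB, hX.sample_law t B' hBm'] with ω h1 h2 h3 _
    rw [h1, Pi.mul_apply, h2, h3, Fin.prod_univ_two, Fin.prod_univ_two]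
    have hs1 : ∀ j, ∏ i, (gaussianReal (X.postMean i t ω) (X.postVar i t ω)).real (B' j i)
        = X.postProb o t b ω * ∏ i ∈ Finset.univ.erase o,
          (gaussianReal (X.postMean i t ω) (X.postVar i t ω)).real (B j i) := by
      intro j
      rw [← Finset.mul_prod_erase _ _ (Finset.mem_univ o)]
      simp only [hB', if_true, Trajectory.postProb]
      congr 1
      refine Finset.prod_congr rfl fun i hi => ?_
      rw [if_neg (Finset.ne_of_mem_erase hi)]
    have hs2 : ∀ j, ∏ i, (gaussianReal (X.postMean i t ω) (X.postVar i t ω)).real (B j i)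
        = ∏ i ∈ Finset.univ.erase o,
          (gaussianReal (X.postMean i t ω) (X.postVar i t ω)).real (B j i) := by
      intro j
      rw [← Finset.mul_prod_erase _ _ (Finset.mem_univ o), hBo]
      simp
    rw [hs1, hs1, hs2, hs2]
    ring
  refine @ext_of_generate_finite _ (X.others o t) _ _ (X.otherRects o t) rfl
    (X.isPiSystem_otherRects o t) (isFiniteMeasure_trim _) key ?_
  exact key _ ⟨Set.univ, fun _ _ => Set.univ, MeasurableSet.univ, fun _ _ => MeasurableSet.univ,
    fun _ => rfl, by simp⟩

lemma IsRun.measure_pair_eq (hX : IsRun ν P X) {b : Set ℝ} (hb : MeasurableSet b) {D : Set Ω}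
    (hD : MeasurableSet[X.others o t] D) :
    P (D ∩ {ω | X.θ 0 o t ω ∈ b ∧ X.θ 1 o t ω ∈ b})
      = ∫⁻ ω in D, ENNReal.ofReal (X.postProb o t b ω ^ 2) ∂P := by
  have h := congrArg (fun μ : @Measure Ω (X.others o t) => μ D) (hX.trim_pair_eq (o := o) (t := t) hb)
  have hD' := hX.others_le o t _ hD
  rwa [trim_measurableSet_eq _ hD, trim_measurableSet_eq _ hD, Measure.restrict_apply hD',
    withDensity_apply _ hD'] at h

/-- Split according to whether the posterior mean exceeds `y`. Above `y` the complement is a pair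
event for `Set.Iic y`; below, the event itself is a pair event for `Set.Ioi y`. -/
lemma IsRun.measure_inter_lt_index (hX : IsRun ν P X) (y : ℝ) {D : Set Ω}
    (hD : MeasurableSet[X.others o t] D) :
    P (D ∩ {ω | y < X.index o t ω}) = ∫⁻ ω in D, ENNReal.ofReal (X.medProb o t y ω) ∂P := by
  have hD' := hX.others_le o t _ hD
  have hH : MeasurableSet[X.history t] {ω | y < X.postMean o t ω} :=
    X.measurable_postMean_history o t (measurableSet_Ioi (a := y))
  have hHo := X.history_le_others o t _ hH
  have hH' := hX.history_le t _ hH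
  have hidx : MeasurableSet {ω | y < X.index o t ω} :=
    hX.measurable_index o t (measurableSet_Ioi (a := y))
  rw [← measure_inter_add_sdiff (D ∩ {ω | y < X.index o t ω}) hH',
    ← lintegral_inter_add_sdiff _ D hH']
  congr 1
  · have hDH := hD.inter hHo
    have h1 := hX.measure_pair_eq (o := o) (t := t) (measurableSet_Iic (a := y)) hDH
    have h2 := measure_inter_add_sdiff (μ := P) (D ∩ {ω | y < X.postMean o t ω}) hidx
    have hset : (D ∩ {ω | y < X.postMean o t ω}) \ {ω | y < X.index o t ω}
        = D ∩ {ω | y < X.postMean o t ω} ∩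
          {ω | X.θ 0 o t ω ∈ Set.Iic y ∧ X.θ 1 o t ω ∈ Set.Iic y} := by
      ext ω
      simp only [Set.mem_sdiff, Set.mem_inter_iff, Set.mem_ofPred_eq, not_lt, Set.mem_Iic]
      refine and_congr_right fun h => ?_
      exact median3_le_iff h.2
    rw [hset, h1] at h2
    have h3 : ∫⁻ ω in D ∩ {ω | y < X.postMean o t ω}, ENNReal.ofReal (X.medProb o t y ω) ∂P
        + ∫⁻ ω in D ∩ {ω | y < X.postMean o t ω},
          ENNReal.ofReal (X.postProb o t (Set.Iic y) ω ^ 2) ∂P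
        = P (D ∩ {ω | y < X.postMean o t ω}) := by
      rw [← lintegral_add_left' (((X.measurable_medProb o t y).mono (hX.history_le t)
        le_rfl).ennreal_ofReal.aemeasurable), ← setLIntegral_one]
      refine setLIntegral_congr_fun (hD'.inter hH') fun ω hω => ?_
      rw [← ENNReal.ofReal_add (X.medProb_pos y ω).le (sq_nonneg _), X.postProb_Iic,
        Trajectory.medProb, if_pos (show y < X.postMean o t ω from hω.2)]
      simp
    have hfin : ∫⁻ ω in D ∩ {ω | y < X.postMean o t ω},
          ENNReal.ofReal (X.postProb o t (Set.Iic y) ω ^ 2) ∂P ≠ ∞ := by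
      rw [← h1]
      exact measure_ne_top _ _
    rw [Set.inter_right_comm]
    exact (ENNReal.add_left_inj hfin).1 (h2.trans h3.symm)
  · have hDH := hD.diff hHo
    have h1 := hX.measure_pair_eq (o := o) (t := t) (measurableSet_Ioi (a := y)) hDH
    have hset : (D ∩ {ω | y < X.index o t ω}) \ {ω | y < X.postMean o t ω}
        = D \ {ω | y < X.postMean o t ω} ∩
          {ω | X.θ 0 o t ω ∈ Set.Ioi y ∧ X.θ 1 o t ω ∈ Set.Ioi y} := by
      ext ω
      simp only [Set.mem_sdiff, Set.mem_inter_iff, Set.mem_ofPred_eq, not_lt, Set.mem_Ioi]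
      constructor
      · rintro ⟨⟨h1, h2⟩, h3⟩
        exact ⟨⟨h1, h3⟩, (lt_median3_iff h3).1 h2⟩
      · rintro ⟨⟨h1, h3⟩, h2⟩
        exact ⟨⟨h1, (lt_median3_iff h3).2 h2⟩, h3⟩
    rw [hset, h1]
    refine setLIntegral_congr_fun (hD'.diff hH') fun ω hω => ?_
    rw [Trajectory.medProb, if_neg (show ¬ y < X.postMean o t ω from hω.2)]

lemma IsRun.measure_inter_index_le (hX : IsRun ν P X) (y : ℝ) {D : Set Ω}
    (hD : MeasurableSet[X.others o t] D) :
    P (D ∩ {ω | X.index o t ω ≤ y}) = ∫⁻ ω in D, ENNReal.ofReal (1 - X.medProb o t y ω) ∂P := by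
  have h1 := hX.measure_inter_lt_index y hD
  have hidx : MeasurableSet {ω | y < X.index o t ω} :=
    hX.measurable_index o t (measurableSet_Ioi (a := y))
  have h2 := measure_inter_add_sdiff (μ := P) D hidx
  have hset : D \ {ω | y < X.index o t ω} = D ∩ {ω | X.index o t ω ≤ y} := by
    ext ω
    simp
  have h3 : ∫⁻ ω in D, ENNReal.ofReal (X.medProb o t y ω) ∂P
      + ∫⁻ ω in D, ENNReal.ofReal (1 - X.medProb o t y ω) ∂P = P D := by
    rw [← lintegral_add_left' (((X.measurable_medProb o t y).mono (hX.history_le t)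
        le_rfl).ennreal_ofReal.aemeasurable), ← setLIntegral_one]
    refine lintegral_congr fun ω => ?_
    rw [← ENNReal.ofReal_add (X.medProb_pos y ω).le (sub_nonneg.2 (X.medProb_le_one y ω))]
    simp
  have hfin : ∫⁻ ω in D, ENNReal.ofReal (X.medProb o t y ω) ∂P ≠ ∞ := by
    rw [← h1]
    exact measure_ne_top _ _
  rw [hset, h1, ← h3] at h2
  exact (ENNReal.add_right_inj hfin).1 h2

/-- Lets a factor `medProb` be traded for the event that the index of `o` is high, against any
integrand that does not involve the samples of `o`. -/
lemma IsRun.setLIntegral_medProb_mul (hX : IsRun ν P X) (y : ℝ) {D : Set Ω}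
    (hD : MeasurableSet[X.others o t] D) {f : Ω → ℝ≥0∞} (hf : Measurable[X.others o t] f) :
    ∫⁻ ω in D, ENNReal.ofReal (X.medProb o t y ω) * f ω ∂P
      = ∫⁻ ω in D ∩ {ω | y < X.index o t ω}, f ω ∂P := by
  have hm := hX.others_le o t
  have hmed := ((X.measurable_medProb o t y).mono (hX.history_le t) le_rfl).ennreal_ofReal
  have hidx : MeasurableSet {ω | y < X.index o t ω} :=
    hX.measurable_index o t (measurableSet_Ioi (a := y))
  have key : ((P.restrict D).withDensity fun ω => ENNReal.ofReal (X.medProb o t y ω)).trim hm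
      = (P.restrict (D ∩ {ω | y < X.index o t ω})).trim hm := by
    refine @Measure.ext _ (X.others o t) _ _ fun s hs => ?_
    rw [trim_measurableSet_eq hm hs, trim_measurableSet_eq hm hs, withDensity_apply _ (hm _ hs),
      Measure.restrict_restrict (hm _ hs), Measure.restrict_apply (hm _ hs), ← Set.inter_assoc,
      hX.measure_inter_lt_index y (hs.inter hD)]
  have h1 := lintegral_trim (μ := (P.restrict D).withDensity
    fun ω => ENNReal.ofReal (X.medProb o t y ω)) hm hf
  rw [key, lintegral_trim hm hf,
    lintegral_withDensity_eq_lintegral_mul _ hmed (hf.mono hm le_rfl)] at h1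
  exact h1.symm

lemma IsRun.condProb_lt_index (hX : IsRun ν P X) (y : ℝ) :
    P⟦{ω | y < X.index o t ω} | X.history t⟧ =ᵐ[P] X.medProb o t y := by
  have hmF := X.measurable_medProb o t y
  have hm := hmF.mono (hX.history_le t) le_rfl
  have hidx : MeasurableSet {ω | y < X.index o t ω} :=
    hX.measurable_index o t (measurableSet_Ioi (a := y))
  have hint : Integrable (X.medProb o t y) P := by
    refine Integrable.of_bound hm.aestronglyMeasurable 1 (Filter.Eventually.of_forall fun ω => ?_)
    rw [Real.norm_of_nonneg (X.medProb_pos y ω).le]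
    exact X.medProb_le_one y ω
  refine (ae_eq_condExp_of_forall_setIntegral_eq (hX.history_le t)
    ((integrable_const _).indicator hidx) (fun s _ _ => hint.integrableOn) (fun s hs _ => ?_)
    hmF.stronglyMeasurable.aestronglyMeasurable).symm
  have h1 := hX.measure_inter_lt_index (o := o) y (X.history_le_others o t _ hs)
  rw [lintegral_ofReal_of_bounded hm (fun ω => (X.medProb_pos y ω).le) (X.medProb_le_one y),
    ← ofReal_measureReal, ENNReal.ofReal_eq_ofReal_iff measureReal_nonneg
    (integral_nonneg fun ω => (X.medProb_pos y ω).le)] at h1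
  rw [← h1, integral_indicator_const _ hidx, measureReal_restrict_apply hidx, Set.inter_comm]
  simp

/-- The probability that the arm played has an index at most `y` is controlled by the probability
of playing arm `o`. -/
lemma IsRun.measure_index_arm_le (hX : IsRun ν P X) (o : Fin K) (t : ℕ) (y : ℝ) :
    P {ω | X.index (X.A t ω) t ω ≤ y} ≤ ∫⁻ ω in {ω | X.A t ω = o},
      ENNReal.ofReal ((1 - X.medProb o t y ω) / X.medProb o t y ω) ∂P := by
  -- If the maximal index is at most `y`, so are all the others. `D` does not involve the samples of
  -- `o`, which are therefore conditionally independent of it.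
  set D : Set Ω := {ω | ∀ i, i ≠ o → X.index i t ω ≤ y} with hDdef
  have hD : MeasurableSet[X.others o t] D := by
    have : D = ⋂ i, ⋂ (_ : i ≠ o), {ω | X.index i t ω ≤ y} := by
      ext ω
      simp [hDdef]
    rw [this]
    refine MeasurableSet.iInter fun i => MeasurableSet.iInter fun hi => ?_
    exact X.measurable_index_others o t hi (measurableSet_Iic (a := y))
  have hmF := (X.measurable_medProb o t y).mono (X.history_le_others o t) le_rfl
  have hf : Measurable[X.others o t] fun ω =>
      ENNReal.ofReal ((1 - X.medProb o t y ω) / X.medProb o t y ω) :=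
    ENNReal.measurable_ofReal.comp ((measurable_const.sub hmF).div hmF)
  calc P {ω | X.index (X.A t ω) t ω ≤ y} ≤ P (D ∩ {ω | X.index o t ω ≤ y}) := by
        refine measure_mono_ae ?_
        filter_upwards [hX.select t] with ω hω h
        exact ⟨fun i _ => (hω i).trans h, (hω o).trans h⟩
    _ = ∫⁻ ω in D, ENNReal.ofReal (1 - X.medProb o t y ω) ∂P := hX.measure_inter_index_le y hD
    _ = ∫⁻ ω in D, ENNReal.ofReal (X.medProb o t y ω) *
        ENNReal.ofReal ((1 - X.medProb o t y ω) / X.medProb o t y ω) ∂P := by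
        refine lintegral_congr fun ω => ?_
        have := X.medProb_pos (o := o) (t := t) y ω
        rw [← ENNReal.ofReal_mul this.le, mul_div_cancel₀ _ this.ne']
    _ = ∫⁻ ω in D ∩ {ω | y < X.index o t ω},
        ENNReal.ofReal ((1 - X.medProb o t y ω) / X.medProb o t y ω) ∂P :=
        hX.setLIntegral_medProb_mul y hD hf
    _ ≤ _ := by
        -- On `D`, once the index of `o` exceeds `y` it is the strict maximum, so `o` is played
        -- whatever the tie-breaking.
        refine lintegral_mono_set' ?_
        filter_upwards [hX.select t] with ω hω h
        by_contra hne
        exact absurd (h.1 _ hne) (not_le.2 (lt_of_lt_of_le h.2 (hω o)))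

end Sampling

/-! ### Bounds for the reference sums of the optimal arm -/

section Instance

variable {Ω : Type*} [mΩ : MeasurableSpace Ω] {K : ℕ} {ν : Fin K → Measure ℝ} {P : Measure Ω}
  {X : Trajectory Ω K}

lemma armMean_mem_Icc [∀ i, IsProbabilityMeasure (ν i)]
    (hsupp : ∀ i, ν i (Set.Icc (0 : ℝ) 1)ᶜ = 0) (i : Fin K) : armMean ν i ∈ Set.Icc (0 : ℝ) 1 := by
  have h : ∀ᵐ x ∂(ν i), x ∈ Set.Icc (0 : ℝ) 1 := hsupp i
  constructor
  · exact integral_nonneg_of_ae (h.mono fun x hx => hx.1)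
  · have hint : Integrable (fun x : ℝ => x) (ν i) :=
      Integrable.of_bound measurable_id.aestronglyMeasurable 1 (h.mono fun x hx => by
        rw [Real.norm_of_nonneg hx.1]
        exact hx.2)
    have := integral_mono_ae hint (integrable_const (1 : ℝ)) (h.mono fun x hx => hx.2)
    rw [armMean]
    simpa using this

lemma highThr_eq (o i : Fin K) : highThr ν o i = armMean ν o - gap ν o i / 3 := by
  unfold highThr gap
  ring

lemma highThr_sub_lowThr (o i : Fin K) : highThr ν o i - lowThr ν o i = gap ν o i / 3 := by
  unfold highThr lowThr
  ring

lemma optTerm_nonneg (o i : Fin K) (T : ℕ) : 0 ≤ optTerm ν o i T := by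
  unfold optTerm
  have h : 1 ≤ (T : ℝ) * gap ν o i ^ 2 + Real.exp 32 := by
    have := Real.one_le_exp (x := 32) (by norm_num)
    have : 0 ≤ (T : ℝ) * gap ν o i ^ 2 := by positivity
    linarith
  have := Real.log_nonneg h
  positivity

namespace Trajectory

omit mΩ in
lemma postMean_nextRound {o : Fin K} {k : ℕ} {ω : Ω} (h : ω ∈ reached X o k) (μ : ℝ) :
    X.postMean o (nextRound X o k ω) ω
      = ((X.rewardSum o (nextRound X o k ω) ω - k * μ) + (((k + 1 : ℝ≥0) : ℝ) - 1) * μ)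
        / ((k + 1 : ℝ≥0) : ℝ) := by
  rw [postMean, X.pulls_nextRound o h]
  push_cast
  ring

omit mΩ in
lemma postVar_nextRound {o : Fin K} {k : ℕ} {ω : Ω} (h : ω ∈ reached X o k) :
    X.postVar o (nextRound X o k ω) ω = (k + 1 : ℝ≥0)⁻¹ := by
  rw [postVar, X.pulls_nextRound o h]

omit mΩ in
lemma reached_inter_postMean (o : Fin K) (k : ℕ) (s : Set ℝ) :
    reached X o k ∩ {ω | X.postMean o (nextRound X o k ω) ω ∈ s}
      = ⋃ t, {ω | X.pulls o t ω = k} ∩ {ω | X.postMean o t ω ∈ s} := by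
  ext ω
  simp only [Set.mem_inter_iff, Set.mem_iUnion, Set.mem_ofPred_eq]
  constructor
  · rintro ⟨h, hs⟩
    exact ⟨_, X.pulls_nextRound o h, hs⟩
  · rintro ⟨t, ht, hs⟩
    have h : ω ∈ reached X o k := ⟨t, ht⟩
    refine ⟨h, ?_⟩
    rwa [X.postMean_congr o ((X.pulls_nextRound o h).trans ht.symm)]

end Trajectory

lemma IsRun.measurableSet_reached_inter (hX : IsRun ν P X) (o : Fin K) (k : ℕ) {s : Set ℝ}
    (hs : MeasurableSet s) :
    MeasurableSet (reached X o k ∩ {ω | X.postMean o (nextRound X o k ω) ω ∈ s}) := by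
  rw [Trajectory.reached_inter_postMean]
  exact MeasurableSet.iUnion fun t =>
    (hX.measurable_pulls o t (measurableSet_singleton k)).inter (hX.measurable_postMean o t hs)

variable [IsProbabilityMeasure P] [∀ i, IsProbabilityMeasure (ν i)] {o i : Fin K}

omit [∀ i, IsProbabilityMeasure (ν i)] in
-- A single null set for all rounds is needed because `pMed` is evaluated at the random round
-- `nextRound`.
lemma IsRun.pMed_ae (hX : IsRun ν P X) :
    ∀ᵐ ω ∂P, ∀ t, pMed ν P X o i t ω = X.medProb o t (highThr ν o i) ω :=
  ae_all_iff.2 fun _ => hX.condProb_lt_index _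

omit [IsProbabilityMeasure P] [∀ i, IsProbabilityMeasure (ν i)] in
lemma IsRun.pOn_ae (hX : IsRun ν P X) :
    ∀ᵐ ω ∂P, ∀ t, pOn ν P X o i t ω = X.postProb o t (Set.Ioi (highThr ν o i)) ω :=
  ae_all_iff.2 fun _ => hX.condProb_sample measurableSet_Ioi

omit [∀ i, IsProbabilityMeasure (ν i)] in
lemma IsRun.sum_underEvent_le (hX : IsRun ν P X) (T : ℕ) :
    ∑ t ∈ Finset.range T, P (underEvent ν X o i t)
      ≤ ratioGood ν P X o i T + ratioBad ν P X o i T := by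
  have h1 : ∀ t ∈ Finset.range T, P (underEvent ν X o i t) ≤ ∫⁻ ω in {ω | X.A t ω = o},
      ENNReal.ofReal ((1 - X.medProb o t (highThr ν o i) ω) / X.medProb o t (highThr ν o i) ω) ∂P :=
    fun t _ => (measure_mono fun ω hω => by
      obtain ⟨hA, _, hy⟩ := hω
      rw [Set.mem_ofPred_eq, hA]
      exact hy).trans (hX.measure_index_arm_le o t _)
  refine (Finset.sum_le_sum h1).trans ((hX.sum_setLIntegral_arm_le o T
    (H := fun k ω => ENNReal.ofReal ((1 - pMed ν P X o i (nextRound X o k ω) ω) /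
        pMed ν P X o i (nextRound X o k ω) ω)) ?_).trans ?_)
  · filter_upwards [hX.pMed_ae (o := o) (i := i)] with ω hω t _
    -- The posterior of `o` depends only on its plays, so it is the same in round `t` as in the
    -- first round with that count.
    have hr : ω ∈ reached X o (X.pulls o t ω) := ⟨t, rfl⟩
    have hp := X.pulls_nextRound o hr
    simp only [hω, Trajectory.medProb, Trajectory.postProb, X.postMean_congr o hp,
      X.postVar_congr o hp]
    exact le_rfl
  · rw [ratioGood, ratioBad, ← Finset.sum_add_distrib]
    refine Finset.sum_le_sum fun k _ => ?_
    refine le_trans (lintegral_mono_set ?_) (lintegral_union_le _ _ _)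
    intro ω hω
    rcases lt_or_ge (highThr ν o i) (X.postMean o (nextRound X o k ω) ω) with h | h
    · exact Or.inl ⟨hω, h⟩
    · exact Or.inr ⟨hω, h⟩

omit [∀ i, IsProbabilityMeasure (ν i)] in
-- With `p = q (2 - q)`, the claim reduces to `(1 - q) ^ 2 / (q (2 - q)) ≤ (1 - q) / (2 q)`, that
-- is, `2 (1 - q) ≤ 2 - q`.
lemma IsRun.ratioGood_le (hX : IsRun ν P X) (T : ℕ) :
    ratioGood ν P X o i T ≤ 1 / 2 * ratioSingle ν P X o i T := by
  rw [ratioGood, ratioSingle, Finset.mul_sum]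
  refine Finset.sum_le_sum fun k _ => ?_
  have h2 : (1 / 2 : ℝ≥0∞) ≠ ∞ := by simp
  rw [← lintegral_const_mul' _ _ h2]
  refine le_trans (setLIntegral_mono_ae' (hX.measurableSet_reached_inter o k
    (measurableSet_Ioi (a := highThr ν o i))) ?_) (lintegral_mono_set Set.inter_subset_left)
  filter_upwards [hX.pMed_ae (o := o) (i := i), hX.pOn_ae (o := o) (i := i)] with ω h h' hω
  have hy : highThr ν o i < X.postMean o (nextRound X o k ω) ω := hω.2
  rw [h, h', Trajectory.medProb, if_pos hy]
  have hq0 := X.postProb_Ioi_pos (o := o) (t := nextRound X o k ω) (highThr ν o i) ω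
  have hq1 := X.postProb_le_one (o := o) (t := nextRound X o k ω) (b := Set.Ioi (highThr ν o i))
    (ω := ω)
  generalize X.postProb o (nextRound X o k ω) (Set.Ioi (highThr ν o i)) ω = q at *
  have hhalf : (1 / 2 : ℝ≥0∞) = ENNReal.ofReal (1 / 2) := by
    rw [ENNReal.ofReal_div_of_pos two_pos]
    simp
  rw [hhalf, ← ENNReal.ofReal_mul (by norm_num)]
  refine ENNReal.ofReal_le_ofReal ?_
  have h1 : 1 - (1 - q) ^ 2 = q * (2 - q) := by ring
  have h3 : 1 / 2 * (1 / q - 1) = (1 - q) / (2 * q) := by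
    field_simp
  rw [h1, h3, div_le_div_iff₀ (by nlinarith) (by linarith)]
  nlinarith [mul_nonneg (mul_nonneg hq0.le hq0.le) (sub_nonneg.2 hq1)]

lemma sum_ofReal_mul_le {a : ℝ} (ha : 0 ≤ a) {Δ : ℝ} (hΔ : 0 < Δ) (T : ℕ) {F : ℕ → ℝ≥0∞}
    (hF : ∀ k, F k ≤ ENNReal.ofReal (a * Real.exp (-((k + 1 : ℝ) * Δ ^ 2 / 144)))
      * ENNReal.ofReal √10) :
    ∑ k ∈ Finset.range T, F k ≤ ENNReal.ofReal (a * √10 * 144 / Δ ^ 2) := by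
  refine (Finset.sum_le_sum fun k _ => hF k).trans ?_
  rw [← Finset.sum_mul, ← ENNReal.ofReal_sum_of_nonneg fun _ _ => by positivity,
    ← ENNReal.ofReal_mul (Finset.sum_nonneg fun _ _ => by positivity), ← Finset.mul_sum]
  refine ENNReal.ofReal_le_ofReal ?_
  have h := sum_exp_neg_le (c := Δ ^ 2 / 144) (by positivity) T
  simp_rw [← mul_div_assoc] at h
  calc a * (∑ k ∈ Finset.range T, Real.exp (-((k + 1 : ℝ) * Δ ^ 2 / 144))) * √10
      ≤ a * (1 / (Δ ^ 2 / 144)) * √10 := by gcongr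
    _ = a * √10 * 144 / Δ ^ 2 := by field_simp

variable (hsupp : ∀ i, ν i (Set.Icc (0 : ℝ) 1)ᶜ = 0)

include hsupp in
lemma IsRun.ratioSingle_le (hX : IsRun ν P X) (hgap : 0 < gap ν o i) (T : ℕ) :
    ratioSingle ν P X o i T ≤ ENNReal.ofReal (tailConst * √10 * 144 / gap ν o i ^ 2) := by
  refine sum_ofReal_mul_le tailConst_pos.le hgap T fun k => ?_
  refine hX.setLIntegral_reached_le hsupp o k ENNReal.ofReal_ne_top ?_
  filter_upwards [hX.pOn_ae (o := o) (i := i)] with ω h hω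
  rw [h, ← ENNReal.ofReal_mul (by have := tailConst_pos; positivity)]
  refine ENNReal.ofReal_le_ofReal ?_
  have hμ := armMean_mem_Icc hsupp o
  have := inv_sub_one_le (n := (k + 1 : ℝ≥0)) (Δ := gap ν o i)
    (Z := X.rewardSum o (nextRound X o k ω) ω - k * armMean ν o) (by simp) hμ.2 hgap.le
  rw [← X.postMean_nextRound hω, ← X.postVar_nextRound hω, ← highThr_eq, mul_right_comm] at this
  push_cast at this
  exact this

include hsupp in
lemma IsRun.ratioBad_le (hX : IsRun ν P X) (hgap : 0 < gap ν o i) (T : ℕ) :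
    ratioBad ν P X o i T ≤ ENNReal.ofReal (tailConst * √10 * 144 / gap ν o i ^ 2) := by
  refine sum_ofReal_mul_le tailConst_pos.le hgap T fun k => ?_
  have hS := hX.measurableSet_reached_inter o k (measurableSet_Iic (a := highThr ν o i))
  set S := reached X o k ∩ {ω | X.postMean o (nextRound X o k ω) ω ∈ Set.Iic (highThr ν o i)}
  set f : Ω → ℝ≥0∞ := fun ω => ENNReal.ofReal ((1 - pMed ν P X o i (nextRound X o k ω) ω) /
        pMed ν P X o i (nextRound X o k ω) ω)
  -- The indicator extends the integrand by zero to all of `reached`, where the concentration bound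
  -- is available.
  calc ∫⁻ ω in S, f ω ∂P = ∫⁻ ω in S, S.indicator f ω ∂P :=
        setLIntegral_congr_fun hS fun ω hω => (Set.indicator_of_mem hω f).symm
    _ ≤ ∫⁻ ω in reached X o k, S.indicator f ω ∂P := lintegral_mono_set Set.inter_subset_left
    _ ≤ _ := ?_
  refine hX.setLIntegral_reached_le hsupp o k ENNReal.ofReal_ne_top ?_
  filter_upwards [hX.pMed_ae (o := o) (i := i)] with ω h hω
  by_cases hωS : ω ∈ S
  · rw [Set.indicator_of_mem hωS]
    have hy : X.postMean o (nextRound X o k ω) ω ≤ highThr ν o i := hωS.2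
    simp only [f]
    rw [h, ← ENNReal.ofReal_mul (by have := tailConst_pos; positivity)]
    refine ENNReal.ofReal_le_ofReal ?_
    have hμ := armMean_mem_Icc hsupp o
    have := inv_sq_le (n := (k + 1 : ℝ≥0)) (Δ := gap ν o i)
      (Z := X.rewardSum o (nextRound X o k ω) ω - k * armMean ν o) (by simp) hμ.2 hgap.le
      (by rwa [← X.postMean_nextRound hω, ← highThr_eq])
    rw [← X.postMean_nextRound hω, ← X.postVar_nextRound hω, ← highThr_eq, mul_right_comm] at this
    push_cast at this
    refine le_trans ?_ this
    have hmed : X.medProb o (nextRound X o k ω) (highThr ν o i) ω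
        = X.postProb o (nextRound X o k ω) (Set.Ioi (highThr ν o i)) ω ^ 2 :=
      if_neg (not_lt.2 hy)
    have hpos := X.medProb_pos (o := o) (t := nextRound X o k ω) (highThr ν o i) ω
    calc _ ≤ 1 / X.medProb o (nextRound X o k ω) (highThr ν o i) ω :=
          div_le_div_of_nonneg_right (by linarith) hpos.le
      _ ≤ _ := by rw [hmed]; exact le_rfl
  · rw [Set.indicator_of_notMem hωS]
    exact zero_le

include hsupp in
lemma IsRun.sum_underEvent_real_le (hX : IsRun ν P X) (hgap : 0 < gap ν o i) (T : ℕ) :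
    ∑ t ∈ Finset.range T, P.real (underEvent ν X o i t)
      ≤ 2 * (tailConst * √10 * 144 / gap ν o i ^ 2) := by
  have hc := tailConst_pos
  have h : ∑ t ∈ Finset.range T, P (underEvent ν X o i t)
      ≤ ENNReal.ofReal (2 * (tailConst * √10 * 144 / gap ν o i ^ 2)) := by
    rw [two_mul, ENNReal.ofReal_add (by positivity) (by positivity)]
    refine (hX.sum_underEvent_le T).trans (add_le_add ?_ (hX.ratioBad_le hsupp hgap T))
    refine (hX.ratioGood_le T).trans (le_trans ?_ (hX.ratioSingle_le hsupp hgap T))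
    -- The factor `1 / 2` can be dropped, since only the order `1 / Δ ^ 2` matters here.
    exact mul_le_of_le_one_left' (by simp)
  simp_rw [measureReal_def]
  rw [← ENNReal.toReal_sum fun _ _ => measure_ne_top _ _]
  exact ENNReal.toReal_le_of_le_ofReal (by positivity) h

include hsupp in
-- An inaccurate mean after `k` plays forces `Z ≥ (k + 1) Δ / 3`. The indicator is then below `exp
-- (9/5 · Z ^ 2 / n) · exp (-n Δ ^ 2 / 144)`, the same shape as for the optimal arm.
lemma IsRun.sum_lowThr_lt_postMean_le (hX : IsRun ν P X) (hgap : 0 < gap ν o i) (T : ℕ) :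
    ∑ t ∈ Finset.range T, P.real {ω | X.A t ω = i ∧ lowThr ν o i < X.postMean i t ω}
      ≤ √10 * 144 / gap ν o i ^ 2 := by
  have hA : ∀ t, MeasurableSet {ω | X.A t ω = i} := fun t =>
    hX.measurable_arm t (measurableSet_singleton i)
  have hm : ∀ t, MeasurableSet {ω | lowThr ν o i < X.postMean i t ω} := fun t =>
    hX.measurable_postMean i t (measurableSet_Ioi (a := lowThr ν o i))
  have h1 : ∀ t ∈ Finset.range T, P {ω | X.A t ω = i ∧ lowThr ν o i < X.postMean i t ω}
      = ∫⁻ ω in {ω | X.A t ω = i},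
        (if lowThr ν o i < X.postMean i t ω then 1 else 0 : ℝ≥0∞) ∂P := by
    intro t _
    have := lintegral_indicator_one (μ := P.restrict {ω | X.A t ω = i}) (hm t)
    rw [Measure.restrict_apply (hm t), Set.inter_comm] at this
    exact this.symm
  have h : ∑ t ∈ Finset.range T, P {ω | X.A t ω = i ∧ lowThr ν o i < X.postMean i t ω}
      ≤ ENNReal.ofReal (√10 * 144 / gap ν o i ^ 2) := by
    rw [Finset.sum_congr rfl h1]
    refine (hX.sum_setLIntegral_arm_le i T (H := fun k ω =>
      if lowThr ν o i < X.postMean i (nextRound X i k ω) ω then 1 else 0) ?_).trans ?_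
    · refine Filter.Eventually.of_forall fun ω t _ => ?_
      have hr : ω ∈ reached X i (X.pulls i t ω) := ⟨t, rfl⟩
      simp only [X.postMean_congr i (X.pulls_nextRound i hr)]
      exact le_rfl
    · rw [← one_mul √10]
      refine sum_ofReal_mul_le zero_le_one hgap T fun k => ?_
      refine hX.setLIntegral_reached_le hsupp i k ENNReal.ofReal_ne_top ?_
      refine Filter.Eventually.of_forall fun ω hω => ?_
      split_ifs with hlt
      · rw [← ENNReal.ofReal_mul (by positivity), one_mul, ← Real.exp_add, ← ENNReal.ofReal_one]
        refine ENNReal.ofReal_le_ofReal (Real.one_le_exp ?_)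
        rw [Trajectory.postMean, X.pulls_nextRound i hω, lt_div_iff₀ (by positivity), lowThr] at hlt
        have hμ := (armMean_mem_Icc hsupp i).1
        have hk : (0 : ℝ) < k + 1 := by positivity
        -- Shrinkage towards the prior mean `0` only helps here: it leaves an extra `armMean ν i ≥
        -- 0` on the favourable side.
        have hZ : (k + 1 : ℝ) * (gap ν o i / 3)
            ≤ X.rewardSum i (nextRound X i k ω) ω - k * armMean ν i := by nlinarith
        have hZ2 := pow_le_pow_left₀ (by positivity) hZ 2
        have : (k + 1 : ℝ) * gap ν o i ^ 2 / 9 ≤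
            (X.rewardSum i (nextRound X i k ω) ω - k * armMean ν i) ^ 2 / (k + 1) := by
          rw [le_div_iff₀ hk]
          refine le_trans (le_of_eq ?_) hZ2
          ring
        have h0 : 0 ≤ (k + 1 : ℝ) * gap ν o i ^ 2 := by positivity
        linarith
      · exact zero_le
  simp_rw [measureReal_def]
  rw [← ENNReal.toReal_sum fun _ _ => measure_ne_top _ _]
  exact ENNReal.toReal_le_of_le_ofReal (by positivity) h

/-! ### The suboptimal-arm term -/

omit [∀ i, IsProbabilityMeasure (ν i)] in
lemma IsRun.sum_few_pulls_le (hX : IsRun ν P X) (i : Fin K) {b : ℝ} (hb : 0 ≤ b) (T : ℕ) :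
    ∑ t ∈ Finset.range T, P.real {ω | X.A t ω = i ∧ X.pulls i t ω < ⌊b⌋₊} ≤ b := by
  have hm : ∀ t, MeasurableSet {ω | X.pulls i t ω < ⌊b⌋₊} := fun t =>
    hX.measurable_pulls i t (measurableSet_Iio (a := ⌊b⌋₊))
  have h1 : ∀ t ∈ Finset.range T, P {ω | X.A t ω = i ∧ X.pulls i t ω < ⌊b⌋₊}
      = ∫⁻ ω in {ω | X.A t ω = i}, (if X.pulls i t ω < ⌊b⌋₊ then 1 else 0 : ℝ≥0∞) ∂P := by
    intro t _
    have := lintegral_indicator_one (μ := P.restrict {ω | X.A t ω = i}) (hm t)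
    rw [Measure.restrict_apply (hm t), Set.inter_comm] at this
    refine this.symm.trans (lintegral_congr fun ω => ?_)
    simp [Set.indicator_apply]
  have h : ∑ t ∈ Finset.range T, P {ω | X.A t ω = i ∧ X.pulls i t ω < ⌊b⌋₊}
      ≤ (⌊b⌋₊ : ℝ≥0∞) := by
    rw [Finset.sum_congr rfl h1]
    refine (hX.sum_setLIntegral_arm_le i T (H := fun k _ => if k < ⌊b⌋₊ then 1 else 0)
      (Filter.Eventually.of_forall fun ω t _ => le_rfl)).trans ?_
    calc _ ≤ ∑ k ∈ Finset.range T, if k < ⌊b⌋₊ then (1 : ℝ≥0∞) else 0 := by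
          refine Finset.sum_le_sum fun k _ => ?_
          rw [setLIntegral_const]
          exact mul_le_of_le_one_right' prob_le_one
      _ ≤ _ := by
          rw [Finset.sum_boole]
          refine Nat.cast_le.2 ?_
          refine (Finset.card_le_card fun k hk => ?_).trans (Finset.card_range ⌊b⌋₊).le
          exact Finset.mem_range.2 (Finset.mem_filter.1 hk).2
  simp_rw [measureReal_def]
  rw [← ENNReal.toReal_sum fun _ _ => measure_ne_top _ _]
  refine (ENNReal.toReal_le_of_le_ofReal (Nat.cast_nonneg _) ?_).trans (Nat.floor_le hb)
  rwa [ENNReal.ofReal_natCast]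

omit [∀ i, IsProbabilityMeasure (ν i)] in
-- An accurate mean puts the median above the upper threshold only if both samples are above it. The
-- square cancels the `1 / 2` in the Gaussian exponent.
lemma IsRun.overEvent_many_pulls_le (hX : IsRun ν P X) (hgap : 0 < gap ν o i) {b : ℝ} (t : ℕ) :
    P.real (overEvent ν X o i t ∩ {ω | ⌊b⌋₊ ≤ X.pulls i t ω})
      ≤ Real.exp (-(b * (highThr ν o i - lowThr ν o i) ^ 2)) := by
  have hxy : lowThr ν o i < highThr ν o i := by
    have := highThr_sub_lowThr (ν := ν) o i
    linarith
  set x := lowThr ν o i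
  set y := highThr ν o i
  set D : Set Ω := {ω | X.postMean i t ω ≤ x} ∩ {ω | ⌊b⌋₊ ≤ X.pulls i t ω} with hDdef
  have hDF : MeasurableSet[X.history t] D := MeasurableSet.inter
    (X.measurable_postMean_history i t (measurableSet_Iic (a := x)))
    (X.measurable_pulls_history i t (measurableSet_Ici (a := ⌊b⌋₊)))
  have hD := X.history_le_others i t _ hDF
  have hD' := hX.history_le t _ hDF
  have h : P (overEvent ν X o i t ∩ {ω | ⌊b⌋₊ ≤ X.pulls i t ω})
      ≤ ENNReal.ofReal (Real.exp (-(b * (y - x) ^ 2))) := by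
    calc _ ≤ P (D ∩ {ω | X.θ 0 i t ω ∈ Set.Ioi y ∧ X.θ 1 i t ω ∈ Set.Ioi y}) := by
          refine measure_mono ?_
          rintro ω ⟨⟨_, hx, hy⟩, hb⟩
          exact ⟨⟨hx, hb⟩, (lt_median3_iff (le_trans hx hxy.le)).1 hy⟩
      _ = ∫⁻ ω in D, ENNReal.ofReal (X.postProb i t (Set.Ioi y) ω ^ 2) ∂P :=
          hX.measure_pair_eq measurableSet_Ioi hD
      _ ≤ ∫⁻ ω in D, ENNReal.ofReal (Real.exp (-(b * (y - x) ^ 2))) ∂P := by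
          refine setLIntegral_mono' hD' fun ω hω => ENNReal.ofReal_le_ofReal ?_
          have hx : X.postMean i t ω ≤ x := hω.1
          have hb : ⌊b⌋₊ ≤ X.pulls i t ω := hω.2
          have hq := gaussianReal_real_Ioi_le (X.postMean i t ω) (X.postVar i t ω)
            (hx.trans hxy.le)
          -- The posterior precision is the count plus one, which compensates for the floor.
          have hbn : b ≤ (X.pulls i t ω : ℝ) + 1 :=
            (Nat.lt_floor_add_one b).le.trans (by exact_mod_cast Nat.succ_le_succ hb)
          calc X.postProb i t (Set.Ioi y) ω ^ 2
              ≤ Real.exp (-(y - X.postMean i t ω) ^ 2 / (2 * X.postVar i t ω)) ^ 2 :=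
                pow_le_pow_left₀ X.postProb_nonneg hq 2
            _ = Real.exp (-(((X.pulls i t ω : ℝ) + 1) * (y - X.postMean i t ω) ^ 2)) := by
                rw [← Real.exp_nat_mul, Trajectory.postVar]
                congr 1
                push_cast
                field_simp
            _ ≤ _ := by
                refine Real.exp_le_exp.2 (neg_le_neg ?_)
                gcongr
      _ ≤ _ := by
          rw [setLIntegral_const]
          exact mul_le_of_le_one_right' prob_le_one
  exact ENNReal.toReal_le_of_le_ofReal (Real.exp_pos _).le h

omit [∀ i, IsProbabilityMeasure (ν i)] in
lemma IsRun.sum_overEvent_le (hX : IsRun ν P X) (hgap : 0 < gap ν o i) (T : ℕ) :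
    ∑ t ∈ Finset.range T, P.real (overEvent ν X o i t)
      ≤ 1 / 2 * subThreshold ν o i T + 1 / gap ν o i ^ 2 := by
  -- `T = 0` is set aside because `T Δ ^ 2` must be positive for its logarithm to be inverted.
  rcases Nat.eq_zero_or_pos T with rfl | hT
  · simp [subThreshold, sq_nonneg]
  set b := 1 / 2 * subThreshold ν o i T with hbdef
  have hsub : 0 < highThr ν o i - lowThr ν o i := by
    rw [highThr_sub_lowThr]
    positivity
  have hb0 : 0 ≤ b := by
    have := le_max_right (Real.log (T * gap ν o i ^ 2)) 0
    rw [hbdef, subThreshold]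
    positivity
  have hu : 0 < (T : ℝ) * gap ν o i ^ 2 := by positivity
  -- Half the classical threshold already gives `exp (-b (y - x) ^ 2) ≤ 1 / (T Δ ^ 2)`, which sums
  -- to `1 / Δ ^ 2` over `T` rounds.
  have hb : Real.log (T * gap ν o i ^ 2) ≤ b * (highThr ν o i - lowThr ν o i) ^ 2 := by
    have : b * (highThr ν o i - lowThr ν o i) ^ 2 = max (Real.log (T * gap ν o i ^ 2)) 0 := by
      rw [hbdef, subThreshold]
      field_simp
    rw [this]
    exact le_max_left _ _
  have h1 : ∀ t ∈ Finset.range T, P.real (overEvent ν X o i t)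
      ≤ P.real {ω | X.A t ω = i ∧ X.pulls i t ω < ⌊b⌋₊} + 1 / (T * gap ν o i ^ 2) := by
    intro t _
    calc P.real (overEvent ν X o i t)
        ≤ P.real ({ω | X.A t ω = i ∧ X.pulls i t ω < ⌊b⌋₊} ∪
          (overEvent ν X o i t ∩ {ω | ⌊b⌋₊ ≤ X.pulls i t ω})) := by
          refine measureReal_mono fun ω hω => ?_
          rcases lt_or_ge (X.pulls i t ω) ⌊b⌋₊ with h | h
          · exact Or.inl ⟨hω.1, h⟩
          · exact Or.inr ⟨hω, h⟩
      _ ≤ _ := measureReal_union_le _ _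
      _ ≤ _ := by
          refine add_le_add le_rfl ((hX.overEvent_many_pulls_le hgap t).trans ?_)
          refine (Real.exp_le_exp.2 (neg_le_neg hb)).trans (le_of_eq ?_)
          rw [Real.exp_neg, Real.exp_log hu, one_div]
  refine (Finset.sum_le_sum h1).trans ?_
  rw [Finset.sum_add_distrib]
  refine add_le_add (hX.sum_few_pulls_le i hb0 T) (le_of_eq ?_)
  have hT' : (T : ℝ) ≠ 0 := by positivity
  rw [Finset.sum_const, Finset.card_range, nsmul_eq_mul]
  field_simp

omit [∀ i, IsProbabilityMeasure (ν i)] in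
lemma IsRun.measure_arm_le (o i : Fin K) (t : ℕ) :
    P.real {ω | X.A t ω = i} ≤ P.real (overEvent ν X o i t) + P.real (underEvent ν X o i t)
      + P.real {ω | X.A t ω = i ∧ lowThr ν o i < X.postMean i t ω} := by
  refine le_trans ?_ ((measureReal_union_le _ _).trans
    (add_le_add (measureReal_union_le _ _) le_rfl))
  refine measureReal_mono fun ω hω => ?_
  rcases lt_or_ge (lowThr ν o i) (X.postMean i t ω) with h | h
  · exact Or.inr ⟨hω, h⟩
  · rcases lt_or_ge (highThr ν o i) (X.index i t ω) with h' | h'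
    · exact Or.inl (Or.inl ⟨hω, h, h'⟩)
    · exact Or.inl (Or.inr ⟨hω, h, h'⟩)

/-! ### Regret decomposition over the arms -/

include hsupp in
lemma IsRun.reward_mem_Icc (hX : IsRun ν P X) (t : ℕ) :
    ∀ᵐ ω ∂P, X.R t ω ∈ Set.Icc (0 : ℝ) 1 := by
  have h : ∀ j, ∀ᵐ ω ∂P, X.A t ω = j → X.R t ω ∈ Set.Icc (0 : ℝ) 1 := by
    intro j
    have hE : MeasurableSet[X.preReward t] {ω | X.A t ω = j} :=
      X.measurable_arm_preReward t (measurableSet_singleton j)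
    have h1 := congrArg (fun μ => μ (Set.Icc (0 : ℝ) 1)ᶜ)
      (hX.map_reward_restrict hE fun ω hω => hω)
    simp only [Measure.smul_apply, hsupp j, smul_zero] at h1
    rw [Measure.map_apply (hX.measurable_reward t) measurableSet_Icc.compl] at h1
    exact (ae_restrict_iff' (hX.preReward_le t _ hE)).1 h1
  filter_upwards [ae_all_iff.2 h] with ω hω
  exact hω _ rfl

include hsupp in
lemma IsRun.integrable_reward (hX : IsRun ν P X) (t : ℕ) : Integrable (X.R t) P :=
  Integrable.of_bound (hX.measurable_reward t).aestronglyMeasurable 1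
    ((hX.reward_mem_Icc hsupp t).mono fun ω hω => by
      rw [Real.norm_of_nonneg hω.1]
      exact hω.2)

include hsupp in
-- Split by the arm played: restricted to `A t = j`, the law of the reward is `ν j` scaled by the
-- probability of that event.
lemma IsRun.integral_reward (hX : IsRun ν P X) (t : ℕ) :
    ∫ ω, X.R t ω ∂P = ∑ j, P.real {ω | X.A t ω = j} * armMean ν j := by
  have hE : ∀ j, MeasurableSet[X.preReward t] {ω | X.A t ω = j} := fun j =>
    X.measurable_arm_preReward t (measurableSet_singleton j)
  have h1 : ∀ j, ∫ ω in {ω | X.A t ω = j}, X.R t ω ∂P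
      = P.real {ω | X.A t ω = j} * armMean ν j := by
    intro j
    rw [armMean, measureReal_def, ← smul_eq_mul, ← integral_smul_measure,
      ← hX.map_reward_restrict (hE j) fun ω hω => hω,
      integral_map (f := fun x : ℝ => x) (hX.measurable_reward t).aemeasurable
        measurable_id.aestronglyMeasurable]
  simp_rw [← h1, ← integral_indicator (hX.preReward_le t _ (hE _))]
  rw [← integral_finsetSum _ fun j _ =>
    (hX.integrable_reward hsupp t).indicator (hX.preReward_le t _ (hE j))]
  congr 1
  funext ω
  rw [Finset.sum_eq_single (X.A t ω)]
  · exact (Set.indicator_of_mem (by rfl) _).symm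
  · intro j _ hj
    exact Set.indicator_of_notMem (fun h => hj (by exact h.symm)) _
  · simp

omit [∀ i, IsProbabilityMeasure (ν i)] in
lemma IsRun.sum_measure_arm (hX : IsRun ν P X) (t : ℕ) :
    ∑ j, P.real {ω | X.A t ω = j} = 1 := by
  have h := measureReal_biUnion_finset (μ := P) (s := Finset.univ)
    (f := fun j => {ω | X.A t ω = j}) (fun i _ j _ hij => Set.disjoint_left.2
      fun ω hi hj => hij ((show X.A t ω = i from hi).symm.trans hj))
    fun j _ => hX.measurable_arm t (measurableSet_singleton j)
  rw [← h]
  have : (⋃ j ∈ Finset.univ, {ω | X.A t ω = j}) = Set.univ := by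
    ext ω
    simp
  rw [this, probReal_univ]

include hsupp in
lemma IsRun.regret_eq (hX : IsRun ν P X) (o : Fin K) (T : ℕ) :
    regret ν P X o T = ∑ i ∈ Finset.univ.erase o,
      gap ν o i * ∑ t ∈ Finset.range T, P.real {ω | X.A t ω = i} := by
  have h1 : ∀ t, armMean ν o - ∫ ω, X.R t ω ∂P
      = ∑ i ∈ Finset.univ.erase o, gap ν o i * P.real {ω | X.A t ω = i} := by
    intro t
    have h2 : ∑ i ∈ Finset.univ.erase o, gap ν o i * P.real {ω | X.A t ω = i}
        = ∑ i, gap ν o i * P.real {ω | X.A t ω = i} := by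
      rw [← Finset.add_sum_erase _ _ (Finset.mem_univ o)]
      simp [gap]
    rw [h2, hX.integral_reward hsupp]
    simp_rw [gap, sub_mul]
    rw [Finset.sum_sub_distrib, ← Finset.mul_sum, hX.sum_measure_arm, mul_one]
    simp_rw [mul_comm]
  rw [regret, integral_finsetSum _ fun t _ => hX.integrable_reward hsupp t]
  have h3 : (T : ℝ) * armMean ν o = ∑ _t ∈ Finset.range T, armMean ν o := by simp
  rw [h3, ← Finset.sum_sub_distrib, Finset.sum_congr rfl fun t _ => h1 t, Finset.sum_comm]
  simp_rw [Finset.mul_sum]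

end Instance

end AnchorTS

theorem mainTheorem2 :
    ∃ C : ℝ, 0 < C ∧
      ∀ {Ω : Type*} [MeasurableSpace Ω] (P : Measure Ω) [IsProbabilityMeasure P]
        {K : ℕ} (ν : Fin K → Measure ℝ) [∀ i, IsProbabilityMeasure (ν i)]
        (_hsupp : ∀ i, ν i (Set.Icc (0 : ℝ) 1)ᶜ = 0)
        (o : Fin K) (_hopt : ∀ i, i ≠ o → AnchorTS.armMean ν i < AnchorTS.armMean ν o)
        (X : AnchorTS.Trajectory Ω K) (_hX : AnchorTS.IsRun ν P X) (T : ℕ),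
        (∀ i, i ≠ o →
          -- suboptimal-arm term
          (∑ t ∈ Finset.range T, P.real (AnchorTS.overEvent ν X o i t)
              ≤ 1 / 2 * AnchorTS.subThreshold ν o i T + 1 / AnchorTS.gap ν o i ^ 2) ∧
          -- optimal-arm term
          (∑ t ∈ Finset.range T, P (AnchorTS.underEvent ν X o i t)
              ≤ AnchorTS.ratioGood ν P X o i T + AnchorTS.ratioBad ν P X o i T) ∧
          (AnchorTS.ratioGood ν P X o i T ≤ 1 / 2 * AnchorTS.ratioSingle ν P X o i T) ∧
          (AnchorTS.ratioSingle ν P X o i T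
              ≤ ENNReal.ofReal (AnchorTS.optTerm ν o i T + C / AnchorTS.gap ν o i ^ 2)) ∧
          (AnchorTS.ratioBad ν P X o i T ≤ ENNReal.ofReal (C / AnchorTS.gap ν o i ^ 2)) ∧
          (∑ t ∈ Finset.range T, P.real (AnchorTS.underEvent ν X o i t)
              ≤ 1 / 2 * AnchorTS.optTerm ν o i T + C / AnchorTS.gap ν o i ^ 2)) ∧
        -- regret bound
        AnchorTS.regret ν P X o T
          ≤ ∑ i ∈ Finset.univ.erase o, AnchorTS.gap ν o i *
              (1 / 2 * AnchorTS.subThreshold ν o i T + 1 / 2 * AnchorTS.optTerm ν o i T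
                + C / AnchorTS.gap ν o i ^ 2) := by
  have hc := AnchorTS.tailConst_pos
  set c : ℝ := AnchorTS.tailConst * √10 * 144 with hcdef
  have hc0 : 0 < c := by positivity
  -- In the regret bound the three summands pay for the under-optimistic plays, the plays with
  -- inaccurate mean, and the additive `1 / Δ ^ 2` of the suboptimal-arm term.
  refine ⟨2 * c + √10 * 144 + 1, by positivity, ?_⟩
  intro Ω _ P _ K ν _ hsupp o hopt X hX T
  have hgap : ∀ i, i ≠ o → 0 < AnchorTS.gap ν o i := fun i hi => sub_pos.2 (hopt i hi)
  have hle : ∀ i, i ≠ o → c / AnchorTS.gap ν o i ^ 2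
      ≤ (2 * c + √10 * 144 + 1) / AnchorTS.gap ν o i ^ 2 := fun i hi => by
    have : 0 ≤ √10 * 144 := by positivity
    have := hgap i hi
    gcongr
    linarith
  have hunder : ∀ i, i ≠ o → ∑ t ∈ Finset.range T, P.real (AnchorTS.underEvent ν X o i t)
      ≤ 2 * (c / AnchorTS.gap ν o i ^ 2) := fun i hi => hX.sum_underEvent_real_le hsupp (hgap i hi) T
  have hopt0 : ∀ i, 0 ≤ AnchorTS.optTerm ν o i T := fun i => AnchorTS.optTerm_nonneg o i T
  refine ⟨fun i hi => ⟨hX.sum_overEvent_le (hgap i hi) T, hX.sum_underEvent_le T,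
    hX.ratioGood_le T, (hX.ratioSingle_le hsupp (hgap i hi) T).trans
      (ENNReal.ofReal_le_ofReal ?_), (hX.ratioBad_le hsupp (hgap i hi) T).trans
      (ENNReal.ofReal_le_ofReal (hle i hi)), ?_⟩, ?_⟩
  · linarith [hle i hi, hopt0 i]
  · have h1 : (2 * c + √10 * 144 + 1) / AnchorTS.gap ν o i ^ 2
        = 2 * (c / AnchorTS.gap ν o i ^ 2) + (√10 * 144 + 1) / AnchorTS.gap ν o i ^ 2 := by ring
    have h2 : 0 ≤ (√10 * 144 + 1) / AnchorTS.gap ν o i ^ 2 := by positivity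
    linarith [hunder i hi, hopt0 i]
  · rw [hX.regret_eq hsupp]
    refine Finset.sum_le_sum fun i hi => ?_
    have hi := Finset.ne_of_mem_erase hi
    refine mul_le_mul_of_nonneg_left ?_ (hgap i hi).le
    refine (Finset.sum_le_sum fun t _ =>
      AnchorTS.IsRun.measure_arm_le (ν := ν) (P := P) (X := X) o i t).trans ?_
    rw [Finset.sum_add_distrib, Finset.sum_add_distrib]
    have h1 := hX.sum_overEvent_le (hgap i hi) T
    have h3 := hX.sum_lowThr_lt_postMean_le hsupp (hgap i hi) T
    have h4 : (2 * c + √10 * 144 + 1) / AnchorTS.gap ν o i ^ 2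
        = 2 * (c / AnchorTS.gap ν o i ^ 2) + √10 * 144 / AnchorTS.gap ν o i ^ 2
          + 1 / AnchorTS.gap ν o i ^ 2 := by ring
    linarith [hunder i hi, hopt0 i]
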